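/- Work in the language of second-order arithmetic, where $\mathsf{RCA}_0$ consists of the basic axioms of arithmetic, induction for $\Sigma^0_1$ formulas and comprehension for $\Delta^0_1$ predicates (with number and set parameters). A quasi-order $(Q,\leq_Q)$ is a set $Q\subseteq\mathbb{N}$ with a reflexive and transitive relation $\leq_Q\,\subseteq Q\times Q$; it is a well quasi-order (wqo) if for every infinite sequence $(q_k)_{k\in\mathbb N}$ in $Q$ there are $i<j$ with $q_i\leq_Q q_j$. For $n\in\mathbb{N}$ (identified with $\{0,\dots,n-1\}$) and a quasi-order $Q$, define on $n\times Q$ $$(m_1,q_1)\leq_{\dot\cup}(m_2,q_2) :\Leftrightarrow m_1=m_2\wedge q_1\leq_Q q_2,\qquad (m_1,q_1)\leq_{\times}(m_2,q_2) :\Leftrightarrow m_1\leq m_2\wedge q_1\leq_Q q_2 .$$ **Theorem.** Over $\mathsf{RCA}_0$ the following principles are equivalent (that is, any two of them hold in the same models of $\mathsf{RCA}_0$; by the completeness theorem this is the same as provability of the equivalences in $\mathsf{RCA}_0$): 1. $\mathrm{WQP}(\dot\cup^\omega)$: $\forall n\,\forall Q\,[\,Q \text{ wqo}\rightarrow (n\times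 Q,\leq_{\dot\cup})\text{ wqo}\,]$; 2. $\mathrm{WQP}(\leq_\times^\omega)$: $\forall n\,\forall Q\,[\,Q \text{ wqo}\rightarrow (n\times Q,\leq_{\times})\text{ wqo}\,]$; 3. $\mathrm{RT}^1_{<\infty}$ (infinite pigeonhole principle): for every $n$ and every $f:\mathbb{N}\to\{0,\dots,n-1\}$ there are an infinite set $A\subseteq\mathbb{N}$ and $i<n$ such that $f(j)=i$ for all $j\in A$; 4. $\mathrm{B}\Sigma^0_2$: for every $\Sigma^0_2$ formula $\varphi(x,y)$ (possibly with number and set parameters) and every $a$, $$\forall x\leq a\,\exists y\,\varphi(x,y)\rightarrow\exists z\,\forall x\leq a\,\exists y\leq z\,\varphi(x,y).$$ -/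

import Mathlib

universe u

/-! ## The language of second-order arithmetic -/

/-- Numerical terms of second-order arithmetic; number variables are indexed by `ℕ`. -/
inductive L2Term : Type
  | var (x : ℕ) : L2Term
  | zero : L2Term
  | one : L2Term
  | add (s t : L2Term) : L2Term
  | mul (s t : L2Term) : L2Term

/-- `t.Occurs x`: the number variable `x` occurs in the term `t`. -/
def L2Term.Occurs (x : ℕ) : L2Term → Prop
  | .var y => y = x
  | .zero => False
  | .one => False
  | .add s t => s.Occurs x ∨ t.Occurs x
  | .mul s t => s.Occurs x ∨ t.Occurs x

/-- Arithmetical formulas of second-order arithmetic: formulas without set quantifiers, but possibly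
with free set variables (indexed by `ℕ`) and free number variables (indexed by `ℕ`). -/
inductive ArithFormula : Type
  | eq (s t : L2Term) : ArithFormula
  | lt (s t : L2Term) : ArithFormula
  | mem (t : L2Term) (X : ℕ) : ArithFormula
  | neg (φ : ArithFormula) : ArithFormula
  | and (φ ψ : ArithFormula) : ArithFormula
  | or (φ ψ : ArithFormula) : ArithFormula
  | imp (φ ψ : ArithFormula) : ArithFormula
  | all (x : ℕ) (φ : ArithFormula) : ArithFormula
  | ex (x : ℕ) (φ : ArithFormula) : ArithFormula

namespace ArithFormula

/-- `Σ⁰₀` formulas: every quantifier is bounded, i.e. of the form `∀ x < t` or `∃ x < t`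
with `x` not occurring in the term `t`. -/
inductive IsBounded : ArithFormula → Prop
  | eq (s t : L2Term) : IsBounded (.eq s t)
  | lt (s t : L2Term) : IsBounded (.lt s t)
  | mem (t : L2Term) (X : ℕ) : IsBounded (.mem t X)
  | neg {φ : ArithFormula} : IsBounded φ → IsBounded (.neg φ)
  | and {φ ψ : ArithFormula} : IsBounded φ → IsBounded ψ → IsBounded (.and φ ψ)
  | or {φ ψ : ArithFormula} : IsBounded φ → IsBounded ψ → IsBounded (.or φ ψ)
  | imp {φ ψ : ArithFormula} : IsBounded φ → IsBounded ψ → IsBounded (.imp φ ψ)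
  | ball {x : ℕ} {t : L2Term} {φ : ArithFormula} : ¬ t.Occurs x → IsBounded φ →
      IsBounded (.all x (.imp (.lt (.var x) t) φ))
  | bex {x : ℕ} {t : L2Term} {φ : ArithFormula} : ¬ t.Occurs x → IsBounded φ →
      IsBounded (.ex x (.and (.lt (.var x) t) φ))

mutual
/-- `Σ⁰ₙ` formulas: `Σ⁰ₙ₊₁` formulas are those of the form `∃ x θ` with `θ` a `Π⁰ₙ` formula. -/
def IsSigma : ℕ → ArithFormula → Prop
  | 0, φ => φ.IsBounded
  | n + 1, φ => ∃ x θ, φ = .ex x θ ∧ IsPi n θ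
/-- `Π⁰ₙ` formulas: `Π⁰ₙ₊₁` formulas are those of the form `∀ x θ` with `θ` a `Σ⁰ₙ` formula. -/
def IsPi : ℕ → ArithFormula → Prop
  | 0, φ => φ.IsBounded
  | n + 1, φ => ∃ x θ, φ = .all x θ ∧ IsSigma n θ
end

end ArithFormula

/-! ## Structures for second-order arithmetic -/

/-- A structure for the language of second-order arithmetic: number variables range over `Num`,
set variables range over the nonempty collection `sets` of subsets of `Num`. -/
structure L2Structure : Type (u + 1) where
  /-- the first-order part -/
  Num : Type u
  zero : Num
  one : Num
  add : Num → Num → Num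
  mul : Num → Num → Num
  lt : Num → Num → Prop
  /-- the second-order part -/
  sets : Set (Set Num)
  sets_nonempty : sets.Nonempty

namespace L2Structure

instance (M : L2Structure.{u}) : Zero M.Num := ⟨M.zero⟩
instance (M : L2Structure.{u}) : One M.Num := ⟨M.one⟩
instance (M : L2Structure.{u}) : Add M.Num := ⟨M.add⟩
instance (M : L2Structure.{u}) : Mul M.Num := ⟨M.mul⟩
instance (M : L2Structure.{u}) : LT M.Num := ⟨M.lt⟩
/-- `x ≤ y` abbreviates `x < y ∨ x = y`. -/
instance (M : L2Structure.{u}) : LE M.Num := ⟨fun x y => x < y ∨ x = y⟩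

variable (M : L2Structure.{u})

/-- The value of a term under the assignment `v` of the number variables. -/
def eval (v : ℕ → M.Num) : L2Term → M.Num
  | .var x => v x
  | .zero => 0
  | .one => 1
  | .add s t => eval v s + eval v t
  | .mul s t => eval v s * eval v t

/-- Tarskian satisfaction, under the assignments `V` of the set variables and `v` of the
number variables. -/
def Sat (V : ℕ → M.sets) : (ℕ → M.Num) → ArithFormula → Prop
  | v, .eq s t => M.eval v s = M.eval v t
  | v, .lt s t => M.eval v s < M.eval v t
  | v, .mem t X => M.eval v t ∈ (V X : Set M.Num)
  | v, .neg φ => ¬ Sat V v φ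
  | v, .and φ ψ => Sat V v φ ∧ Sat V v ψ
  | v, .or φ ψ => Sat V v φ ∨ Sat V v ψ
  | v, .imp φ ψ => Sat V v φ → Sat V v ψ
  | v, .all x φ => ∀ a : M.Num, Sat V (Function.update v x a) φ
  | v, .ex x φ => ∃ a : M.Num, Sat V (Function.update v x a) φ

/-- `M` is a model of `RCA₀`: the basic axioms, `Σ⁰₁` induction and `Δ⁰₁` comprehension, the schemas
being taken with arbitrary number and set parameters from `M`. -/
structure IsModelRCA0 : Prop where
  succ_ne_zero : ∀ n : M.Num, n + 1 ≠ 0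
  succ_inj : ∀ m n : M.Num, m + 1 = n + 1 → m = n
  add_zero : ∀ m : M.Num, m + 0 = m
  add_succ : ∀ m n : M.Num, m + (n + 1) = (m + n) + 1
  mul_zero : ∀ m : M.Num, m * 0 = 0
  mul_succ : ∀ m n : M.Num, m * (n + 1) = m * n + m
  not_lt_zero : ∀ m : M.Num, ¬ m < 0
  lt_succ_iff : ∀ m n : M.Num, m < n + 1 ↔ m < n ∨ m = n
  sigma1_induction : ∀ φ : ArithFormula, φ.IsSigma 1 →
    ∀ (x : ℕ) (V : ℕ → M.sets) (v : ℕ → M.Num),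
      M.Sat V (Function.update v x 0) φ →
      (∀ n : M.Num, M.Sat V (Function.update v x n) φ →
        M.Sat V (Function.update v x (n + 1)) φ) →
      ∀ n : M.Num, M.Sat V (Function.update v x n) φ
  delta1_comprehension : ∀ φ ψ : ArithFormula, φ.IsSigma 1 → ψ.IsPi 1 →
    ∀ (x : ℕ) (V : ℕ → M.sets) (v : ℕ → M.Num),
      (∀ n : M.Num, M.Sat V (Function.update v x n) φ ↔ M.Sat V (Function.update v x n) ψ) →
      ∃ X ∈ M.sets, ∀ n : M.Num, n ∈ X ↔ M.Sat V (Function.update v x n) φ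

/-! ## The principles

All of them are interpreted inside `M`: number quantifiers range over `M.Num`,
set quantifiers range over `M.sets`. -/

variable {M}

/-- The numerical code `(x + y)² + x` of the ordered pair of `x` and `y`. -/
def pair (x y : M.Num) : M.Num := (x + y) * (x + y) + x

/-- `F` is (the graph of) a function of `M` from all the numbers to the set `A`. -/
def IsFun (F A : Set M.Num) : Prop :=
  F ∈ M.sets ∧ (∀ z ∈ F, ∃ i a : M.Num, z = pair i a) ∧
    (∀ i : M.Num, ∃ a ∈ A, pair i a ∈ F) ∧
    ∀ i a b : M.Num, pair i a ∈ F → pair i b ∈ F → a = b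

/-- `(Q, R)` is a quasi-order of `M`: `Q` and `R` are sets of `M` and (as a set of coded pairs) `R`
is a reflexive and transitive relation on `Q`. -/
def IsQuasiOrder (Q R : Set M.Num) : Prop :=
  Q ∈ M.sets ∧ R ∈ M.sets ∧
    (∀ z ∈ R, ∃ p ∈ Q, ∃ q ∈ Q, z = pair p q) ∧
    (∀ q ∈ Q, pair q q ∈ R) ∧
    ∀ p ∈ Q, ∀ q ∈ Q, ∀ r ∈ Q, pair p q ∈ R → pair q r ∈ R → pair p r ∈ R

/-- `(Q, R)` is a well quasi-order of `M`: every infinite sequence of `M` in `Q` is good. -/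
def IsWqo (Q R : Set M.Num) : Prop :=
  IsQuasiOrder Q R ∧
    ∀ F : Set M.Num, IsFun F Q →
      ∃ i j p q : M.Num, i < j ∧ pair i p ∈ F ∧ pair j q ∈ F ∧ pair p q ∈ R

/-- The base set `n × Q`, where `n` is identified with `{0, …, n - 1}`. -/
def copies (n : M.Num) (Q : Set M.Num) : Set M.Num :=
  {z | ∃ m q : M.Num, m < n ∧ q ∈ Q ∧ z = pair m q}

/-- The disjoint order on `n × Q`: `(m₁, q₁) ≤ (m₂, q₂)` iff `m₁ = m₂` and `q₁ ≤ q₂`. -/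
def disjointOrder (n : M.Num) (Q R : Set M.Num) : Set M.Num :=
  {z | ∃ m₁ m₂ q₁ q₂ : M.Num, m₁ < n ∧ m₂ < n ∧ q₁ ∈ Q ∧ q₂ ∈ Q ∧
    (m₁ = m₂ ∧ pair q₁ q₂ ∈ R) ∧ z = pair (pair m₁ q₁) (pair m₂ q₂)}

/-- The product order on `n × Q`: `(m₁, q₁) ≤ (m₂, q₂)` iff `m₁ ≤ m₂` and `q₁ ≤ q₂`. -/
def productOrder (n : M.Num) (Q R : Set M.Num) : Set M.Num :=
  {z | ∃ m₁ m₂ q₁ q₂ : M.Num, m₁ < n ∧ m₂ < n ∧ q₁ ∈ Q ∧ q₂ ∈ Q ∧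
    (m₁ ≤ m₂ ∧ pair q₁ q₂ ∈ R) ∧ z = pair (pair m₁ q₁) (pair m₂ q₂)}

variable (M)

/-- For all `n` and `Q`, if `Q` is a wqo then so is `n × Q` with the disjoint order. -/
def WQPDisjointUnion : Prop :=
  ∀ (n : M.Num) (Q R : Set M.Num), IsWqo Q R → IsWqo (copies n Q) (disjointOrder n Q R)

/-- For all `n` and `Q`, if `Q` is a wqo then so is `n × Q` with the product order. -/
def WQPProductOrder : Prop :=
  ∀ (n : M.Num) (Q R : Set M.Num), IsWqo Q R → IsWqo (copies n Q) (productOrder n Q R)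

/-- The infinite pigeonhole principle `RT¹_{<∞}`: for every `n` and `f : ℕ → {0, …, n - 1}` there
are an infinite set `A` and `i < n` such that `f j = i` for all `j ∈ A`. -/
def InfinitePigeonhole : Prop :=
  ∀ (n : M.Num) (F : Set M.Num), IsFun F {m | m < n} →
    ∃ A ∈ M.sets, (∀ k : M.Num, ∃ j ∈ A, k < j) ∧ ∃ i < n, ∀ j ∈ A, pair j i ∈ F

/-- The collection schema `BΣ⁰₂`, with arbitrary number and set parameters. -/
def BSigma2 : Prop :=
  ∀ φ : ArithFormula, φ.IsSigma 2 →
    ∀ (x y : ℕ), x ≠ y → ∀ (V : ℕ → M.sets) (v : ℕ → M.Num) (a : M.Num),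
      (∀ b ≤ a, ∃ c : M.Num, M.Sat V (Function.update (Function.update v x b) y c) φ) →
      ∃ d : M.Num, ∀ b ≤ a, ∃ c ≤ d, M.Sat V (Function.update (Function.update v x b) y c) φ

end L2Structure

/-!
The argument takes place inside a model `M` of `RCA₀`.

Definability is handled semantically: `IsDelta0` and `IsSigma1` are classes of predicates on
sequences of numbers of `M`, closed under the usual operations by instances. Substitution is
available because a bounded formula stays definable when its variables are replaced by terms
(`IsDelta0.sat`). Induction and comprehension then apply to any predicate whose definability is
found by instance search. They make the first-order part of `M` an ordered semiring, and yield
bounding for `Σ⁰₀` predicates (`exists_bound`) and codes for finite sets (`exists_code`), hence the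
iteration of functions (`exists_iterates`) and increasing enumerations of infinite sets
(`exists_increasing_enumeration`).

The disjoint order is contained in the product order, so the first principle implies the second.

For the second to imply pigeonhole, order the numbers by decreasing colour and, inside a colour,
decreasingly. A bad sequence for this order has weakly increasing colours, which stabilize, and is
increasing from there on, so it yields an infinite monochromatic set. If there is none, the order is
a wqo. But then `k ↦ (colour of k, k)` is bad for the product order.

Pigeonhole gives a sequence in `n × Q` a subsequence with constant first component, and this
reduces the disjoint order to `Q`.

`BΣ⁰₂` implies pigeonhole by collecting bounds for the occurrences of the colours. Conversely, given
`∀ b ≤ a, ∃ c e, ∀ g, T b c e g`, colour the stage `s` by an argument `b ≤ a` whose least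
witnesses not refuted before `s` are as large as possible. If some `b` is the colour of infinitely
many stages, the least witnesses of all arguments are bounded, at these stages, by true witnesses
for `b`. By bounding they are then true witnesses themselves.
-/

/-! ### Renaming variables -/

/-- Apply `g` to the (number) variables of a term. -/
def L2Term.rename (g : ℕ → ℕ) : L2Term → L2Term
  | .var x => .var (g x)
  | .zero => .zero
  | .one => .one
  | .add s t => .add (s.rename g) (t.rename g)
  | .mul s t => .mul (s.rename g) (t.rename g)

theorem L2Term.occurs_rename {g : ℕ → ℕ} (hg : g.Injective) (t : L2Term) (x : ℕ) :
    (t.rename g).Occurs (g x) ↔ t.Occurs x := by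
  induction t with
  | var y => exact hg.eq_iff
  | zero => rfl
  | one => rfl
  | add s t ihs iht => exact or_congr ihs iht
  | mul s t ihs iht => exact or_congr ihs iht

/-- Apply `g` to the number variables, bound or free, and `h` to the set variables of a formula. -/
def ArithFormula.rename (g h : ℕ → ℕ) : ArithFormula → ArithFormula
  | .eq s t => .eq (s.rename g) (t.rename g)
  | .lt s t => .lt (s.rename g) (t.rename g)
  | .mem t X => .mem (t.rename g) (h X)
  | .neg φ => .neg (φ.rename g h)
  | .and φ ψ => .and (φ.rename g h) (ψ.rename g h)
  | .or φ ψ => .or (φ.rename g h) (ψ.rename g h)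
  | .imp φ ψ => .imp (φ.rename g h) (ψ.rename g h)
  | .all x φ => .all (g x) (φ.rename g h)
  | .ex x φ => .ex (g x) (φ.rename g h)

theorem ArithFormula.IsBounded.rename {g : ℕ → ℕ} (hg : g.Injective) (h : ℕ → ℕ)
    {φ : ArithFormula} (hφ : φ.IsBounded) : (φ.rename g h).IsBounded := by
  induction hφ with
  | eq s t => exact .eq _ _
  | lt s t => exact .lt _ _
  | mem t X => exact .mem _ _
  | neg _ ih => exact .neg ih
  | and _ _ ih₁ ih₂ => exact .and ih₁ ih₂
  | or _ _ ih₁ ih₂ => exact .or ih₁ ih₂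
  | imp _ _ ih₁ ih₂ => exact .imp ih₁ ih₂
  | ball hx _ ih => exact .ball (fun h' => hx ((L2Term.occurs_rename hg _ _).1 h')) ih
  | bex hx _ ih => exact .bex (fun h' => hx ((L2Term.occurs_rename hg _ _).1 h')) ih

namespace L2Structure

variable {M : L2Structure.{u}}

theorem eval_rename (g : ℕ → ℕ) (v : ℕ → M.Num) (t : L2Term) :
    M.eval v (t.rename g) = M.eval (v ∘ g) t := by
  induction t with
  | var x => rfl
  | zero => rfl
  | one => rfl
  | add s t ihs iht => exact congrArg₂ (fun a b : M.Num => a + b) ihs iht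
  | mul s t ihs iht => exact congrArg₂ (fun a b : M.Num => a * b) ihs iht

theorem eval_update_of_not_occurs {t : L2Term} {x : ℕ} (hx : ¬ t.Occurs x) (v : ℕ → M.Num)
    (a : M.Num) : M.eval (Function.update v x a) t = M.eval v t := by
  induction t with
  | var y => exact Function.update_of_ne hx a v
  | zero => rfl
  | one => rfl
  | add s t ihs iht =>
    exact congrArg₂ (fun a b : M.Num => a + b) (ihs fun h => hx (Or.inl h))
      (iht fun h => hx (Or.inr h))
  | mul s t ihs iht =>
    exact congrArg₂ (fun a b : M.Num => a * b) (ihs fun h => hx (Or.inl h))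
      (iht fun h => hx (Or.inr h))

theorem sat_rename {g : ℕ → ℕ} (hg : g.Injective) (h : ℕ → ℕ) (V : ℕ → M.sets)
    (v : ℕ → M.Num) (φ : ArithFormula) :
    M.Sat V v (φ.rename g h) ↔ M.Sat (V ∘ h) (v ∘ g) φ := by
  induction φ generalizing v with
  | eq s t => simp [ArithFormula.rename, Sat, eval_rename]
  | lt s t => simp [ArithFormula.rename, Sat, eval_rename]
  | mem t X => simp [ArithFormula.rename, Sat, eval_rename]
  | neg φ ih => exact not_congr (ih v)
  | and φ ψ ih₁ ih₂ => exact and_congr (ih₁ v) (ih₂ v)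
  | or φ ψ ih₁ ih₂ => exact or_congr (ih₁ v) (ih₂ v)
  | imp φ ψ ih₁ ih₂ => exact imp_congr (ih₁ v) (ih₂ v)
  | all x φ ih =>
    refine forall_congr' fun a => (ih _).trans ?_
    rw [Function.update_comp_eq_of_injective v hg x a]
  | ex x φ ih =>
    refine exists_congr fun a => (ih _).trans ?_
    rw [Function.update_comp_eq_of_injective v hg x a]

/-! ### Predicates definable by bounded formulas -/

/-- The bijection between two copies of `ℕ` and `ℕ` that splits the variables into arguments
`split (.inl i)` and parameters `split (.inr j)`. -/
def split : ℕ ⊕ ℕ ≃ ℕ := Equiv.natSumNatEquivNat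

/-- The assignment with values `u` on the arguments and `p` on the parameters. -/
def join {α : Type*} (u p : ℕ → α) : ℕ → α := fun i => Sum.elim u p (split.symm i)

/-- The sequence `a, u 0, u 1, …`. -/
def scons {α : Type*} (a : α) (u : ℕ → α) : ℕ → α
  | 0 => a
  | i + 1 => u i

/-- The renaming of variables induced by a map on arguments and parameters. -/
def varMap (f : ℕ ⊕ ℕ → ℕ ⊕ ℕ) (i : ℕ) : ℕ := split (f (split.symm i))

theorem varMap_injective {f : ℕ ⊕ ℕ → ℕ ⊕ ℕ} (hf : f.Injective) : (varMap f).Injective :=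
  split.injective.comp (hf.comp split.symm.injective)

/-- All renamings of the variables used below are justified by this identity. -/
theorem join_comp_varMap {α : Type*} {u p u' p' : ℕ → α} {f : ℕ ⊕ ℕ → ℕ ⊕ ℕ}
    (h : ∀ z, Sum.elim u p (f z) = Sum.elim u' p' z) : join u p ∘ varMap f = join u' p' := by
  funext i
  simp [join, varMap, h]

theorem update_join_inl {α : Type*} (u p : ℕ → α) (i : ℕ) (a : α) :
    Function.update (join u p) (split (.inl i)) a = join (Function.update u i a) p := by
  funext j
  obtain ⟨z, rfl⟩ := split.surjective j
  rcases z with k | k <;> simp [join, Function.update_apply]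

theorem update_join_inr {α : Type*} (u p : ℕ → α) (i : ℕ) (a : α) :
    Function.update (join u p) (split (.inr i)) a = join u (Function.update p i a) := by
  funext j
  obtain ⟨z, rfl⟩ := split.surjective j
  rcases z with k | k <;> simp [join, Function.update_apply]

theorem update_scons_zero {α : Type*} (a b : α) (p : ℕ → α) :
    Function.update (scons a p) 0 b = scons b p := by
  funext i
  cases i <;> simp [scons]

/-- The renaming that turns the argument `0` into the parameter `0`. -/
def bindMap : ℕ ⊕ ℕ → ℕ ⊕ ℕ
  | .inl 0 => .inr 0
  | .inl (i + 1) => .inl i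
  | .inr j => .inr (j + 1)

theorem bindMap_injective : bindMap.Injective := by
  rintro ((_ | i) | i) ((_ | j) | j) h <;> simp_all [bindMap]

/-- The renaming that frees the parameter `0`. -/
def freeMap : ℕ ⊕ ℕ → ℕ ⊕ ℕ := Sum.map id Nat.succ

theorem freeMap_injective : freeMap.Injective :=
  Function.injective_id.sumMap Nat.succ_injective

theorem update_join_comp_bindMap {α : Type*} (u p : ℕ → α) (c a : α) :
    Function.update (join u (scons c p)) (split (.inr 0)) a ∘ varMap bindMap =
      join (scons a u) p := by
  rw [update_join_inr, update_scons_zero]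
  exact join_comp_varMap (by rintro ((_ | i) | i) <;> rfl)

theorem update_join_comp_freeMap {α : Type*} (u p : ℕ → α) (c a : α) :
    Function.update (join u (scons c p)) (split (.inr 0)) a ∘ varMap freeMap = join u p := by
  rw [update_join_inr, update_scons_zero]
  exact join_comp_varMap (by rintro (i | i) <;> rfl)

theorem not_occurs_rename_freeMap (t : L2Term) :
    ¬ (t.rename (varMap freeMap)).Occurs (split (.inr 0)) := by
  induction t with
  | var x =>
    intro h
    have h' := split.injective h
    rcases hx : split.symm x with i | i <;> simp [hx, freeMap] at h'
  | zero => exact id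
  | one => exact id
  | add s t ihs iht => exact not_or.2 ⟨ihs, iht⟩
  | mul s t ihs iht => exact not_or.2 ⟨ihs, iht⟩

/-- The renaming of the parameter `j` to `split (s j)`. With `s` the two inclusions, it makes the
parameters of two predicates disjoint. -/
def halfMap (s : ℕ → ℕ ⊕ ℕ) : ℕ ⊕ ℕ → ℕ ⊕ ℕ := Sum.map id fun j => split (s j)

theorem halfMap_injective {s : ℕ → ℕ ⊕ ℕ} (hs : s.Injective) : (halfMap s).Injective :=
  Function.injective_id.sumMap (split.injective.comp hs)

/-- The function `f` of the sequence of arguments is given by a term with parameters. -/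
class IsTerm (f : (ℕ → M.Num) → M.Num) : Prop where
  exists_term : ∃ (t : L2Term) (p : ℕ → M.Num), ∀ u, M.eval (join u p) t = f u

/-- The predicate `P` on sequences of arguments is defined by a bounded formula with number and
set parameters. -/
class IsDelta0 (P : (ℕ → M.Num) → Prop) : Prop where
  exists_formula : ∃ (φ : ArithFormula) (V : ℕ → M.sets) (p : ℕ → M.Num),
    φ.IsBounded ∧ ∀ u, M.Sat V (join u p) φ ↔ P u

/-- Two terms may be assumed to have the same parameters. -/
theorem IsTerm.exists_common {f g : (ℕ → M.Num) → M.Num} (hf : IsTerm f) (hg : IsTerm g) :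
    ∃ (s t : L2Term) (p : ℕ → M.Num), ∀ u, M.eval (join u p) s = f u ∧
      M.eval (join u p) t = g u := by
  obtain ⟨s, p, hs⟩ := hf.exists_term
  obtain ⟨t, q, ht⟩ := hg.exists_term
  refine ⟨s.rename (varMap (halfMap .inl)), t.rename (varMap (halfMap .inr)), join p q,
    fun u => ⟨?_, ?_⟩⟩
  · rw [eval_rename, join_comp_varMap (u' := u) (p' := p), hs]
    rintro (i | i) <;> simp [halfMap, join]
  · rw [eval_rename, join_comp_varMap (u' := u) (p' := q), ht]
    rintro (i | i) <;> simp [halfMap, join]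

theorem IsDelta0.exists_common {P Q : (ℕ → M.Num) → Prop} (hP : IsDelta0 P) (hQ : IsDelta0 Q) :
    ∃ (φ ψ : ArithFormula) (V : ℕ → M.sets) (p : ℕ → M.Num), φ.IsBounded ∧ ψ.IsBounded ∧
      ∀ u, (M.Sat V (join u p) φ ↔ P u) ∧ (M.Sat V (join u p) ψ ↔ Q u) := by
  obtain ⟨φ, V, p, hφ, hP⟩ := hP.exists_formula
  obtain ⟨ψ, W, q, hψ, hQ⟩ := hQ.exists_formula
  have i₁ := varMap_injective (halfMap_injective Sum.inl_injective)
  have i₂ := varMap_injective (halfMap_injective Sum.inr_injective)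
  have e₁ : join V W ∘ (fun i => split (.inl i)) = V := by funext i; simp [join]
  have e₂ : join V W ∘ (fun i => split (.inr i)) = W := by funext i; simp [join]
  refine ⟨φ.rename (varMap (halfMap .inl)) fun i => split (.inl i),
    ψ.rename (varMap (halfMap .inr)) fun i => split (.inr i), join V W, join p q,
    hφ.rename i₁ _, hψ.rename i₂ _, fun u => ⟨?_, ?_⟩⟩
  · rw [sat_rename i₁, join_comp_varMap (u' := u) (p' := p), e₁, hP]
    rintro (i | i) <;> simp [halfMap, join]
  · rw [sat_rename i₂, join_comp_varMap (u' := u) (p' := q), e₂, hQ]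
    rintro (i | i) <;> simp [halfMap, join]

theorem IsDelta0.exists_common_term {P : (ℕ → M.Num) → Prop} {f : (ℕ → M.Num) → M.Num}
    (hP : IsDelta0 P) (hf : IsTerm f) :
    ∃ (φ : ArithFormula) (t : L2Term) (V : ℕ → M.sets) (p : ℕ → M.Num), φ.IsBounded ∧
      ∀ u, (M.Sat V (join u p) φ ↔ P u) ∧ M.eval (join u p) t = f u := by
  obtain ⟨φ, V, p, hφ, hP⟩ := hP.exists_formula
  obtain ⟨t, q, ht⟩ := hf.exists_term
  have i₁ := varMap_injective (halfMap_injective Sum.inl_injective)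
  refine ⟨φ.rename (varMap (halfMap .inl)) id, t.rename (varMap (halfMap .inr)), V,
    join p q, hφ.rename i₁ _, fun u => ⟨?_, ?_⟩⟩
  · rw [sat_rename i₁, join_comp_varMap (u' := u) (p' := p), Function.comp_id, hP]
    rintro (i | i) <;> simp [halfMap, join]
  · rw [eval_rename, join_comp_varMap (u' := u) (p' := q), ht]
    rintro (i | i) <;> simp [halfMap, join]

section Terms

variable {s t : (ℕ → M.Num) → M.Num}

instance IsTerm.var (i : ℕ) : IsTerm fun u : ℕ → M.Num => u i :=
  ⟨.var (split (.inl i)), fun _ => 0, fun u => by simp [eval, join]⟩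

instance IsTerm.const (c : M.Num) : IsTerm fun _ : ℕ → M.Num => c :=
  ⟨.var (split (.inr 0)), fun _ => c, fun u => by simp [eval, join]⟩

instance IsTerm.add [hs : IsTerm s] [ht : IsTerm t] : IsTerm fun u => s u + t u := by
  obtain ⟨s', t', p, h⟩ := hs.exists_common ht
  exact ⟨.add s' t', p, fun u => by simp only [eval, h u]⟩

instance IsTerm.mul [hs : IsTerm s] [ht : IsTerm t] : IsTerm fun u => s u * t u := by
  obtain ⟨s', t', p, h⟩ := hs.exists_common ht
  exact ⟨.mul s' t', p, fun u => by simp only [eval, h u]⟩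

instance IsTerm.pair [hs : IsTerm s] [ht : IsTerm t] : IsTerm fun u => pair (s u) (t u) := by
  unfold L2Structure.pair
  infer_instance

theorem IsTerm.eval {σ : (ℕ → M.Num) → ℕ → M.Num} (hσ : ∀ i, IsTerm fun u => σ u i)
    (t : L2Term) : IsTerm fun u => M.eval (σ u) t := by
  induction t with
  | var x => exact hσ x
  | zero => exact IsTerm.const 0
  | one => exact IsTerm.const 1
  | add s t _ _ => exact IsTerm.add
  | mul s t _ _ => exact IsTerm.mul

/-- Substitution of terms for the arguments. -/
instance IsTerm.comp {f : (ℕ → M.Num) → M.Num} [hf : IsTerm f]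
    {σ : (ℕ → M.Num) → ℕ → M.Num} [hσ : ∀ i, IsTerm fun u => σ u i] :
    IsTerm fun u => f (σ u) := by
  obtain ⟨t, p, h⟩ := hf.exists_term
  have := IsTerm.eval (σ := fun u => join (σ u) p) (fun i => by
    unfold join
    rcases split.symm i with j | j
    · exact hσ j
    · exact IsTerm.const _) t
  simpa only [h] using this

theorem IsTerm.update {σ : (ℕ → M.Num) → ℕ → M.Num} (hσ : ∀ i, IsTerm fun u => σ u i) (x : ℕ)
    [ht : IsTerm t] (i : ℕ) : IsTerm fun u => Function.update (σ u) x (t u) i := by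
  by_cases hi : i = x
  · subst hi
    simpa using ht
  · simpa [hi] using hσ i

end Terms

namespace IsDelta0

variable {s t : (ℕ → M.Num) → M.Num} {P Q : (ℕ → M.Num) → Prop}

theorem congr [hP : IsDelta0 P] (h : ∀ u, P u ↔ Q u) : IsDelta0 Q :=
  (funext fun u => propext (h u) : P = Q) ▸ hP

instance eq [hs : IsTerm s] [ht : IsTerm t] : IsDelta0 fun u => s u = t u := by
  obtain ⟨s', t', p, h⟩ := hs.exists_common ht
  obtain ⟨X, hX⟩ := M.sets_nonempty
  exact ⟨.eq s' t', fun _ => ⟨X, hX⟩, p, .eq _ _, fun u => by simp only [Sat, h u]⟩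

instance lt [hs : IsTerm s] [ht : IsTerm t] : IsDelta0 fun u => s u < t u := by
  obtain ⟨s', t', p, h⟩ := hs.exists_common ht
  obtain ⟨X, hX⟩ := M.sets_nonempty
  exact ⟨.lt s' t', fun _ => ⟨X, hX⟩, p, .lt _ _, fun u => by simp only [Sat, h u]⟩

instance mem [hs : IsTerm s] (X : Set M.Num) [hX : Fact (X ∈ M.sets)] :
    IsDelta0 fun u => s u ∈ X := by
  obtain ⟨s', p, h⟩ := hs.exists_term
  exact ⟨.mem s' 0, fun _ => ⟨X, hX.out⟩, p, .mem _ _, fun u => by simp only [Sat, h u]⟩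

instance not [hP : IsDelta0 P] : IsDelta0 fun u => ¬ P u := by
  obtain ⟨φ, V, p, hφ, h⟩ := hP.exists_formula
  exact ⟨.neg φ, V, p, .neg hφ, fun u => by simp only [Sat, h u]⟩

instance and [hP : IsDelta0 P] [hQ : IsDelta0 Q] : IsDelta0 fun u => P u ∧ Q u := by
  obtain ⟨φ, ψ, V, p, hφ, hψ, h⟩ := hP.exists_common hQ
  exact ⟨.and φ ψ, V, p, .and hφ hψ, fun u => by simp only [Sat, h u]⟩

instance or [hP : IsDelta0 P] [hQ : IsDelta0 Q] : IsDelta0 fun u => P u ∨ Q u := by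
  obtain ⟨φ, ψ, V, p, hφ, hψ, h⟩ := hP.exists_common hQ
  exact ⟨.or φ ψ, V, p, .or hφ hψ, fun u => by simp only [Sat, h u]⟩

instance imp [hP : IsDelta0 P] [hQ : IsDelta0 Q] : IsDelta0 fun u => P u → Q u := by
  obtain ⟨φ, ψ, V, p, hφ, hψ, h⟩ := hP.exists_common hQ
  exact ⟨.imp φ ψ, V, p, .imp hφ hψ, fun u => by simp only [Sat, h u]⟩

instance iff [hP : IsDelta0 P] [hQ : IsDelta0 Q] : IsDelta0 fun u => P u ↔ Q u :=
  congr (P := fun u => (P u → Q u) ∧ (Q u → P u)) fun _ => iff_def.symm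

instance le [hs : IsTerm s] [ht : IsTerm t] : IsDelta0 fun u => s u ≤ t u :=
  or (P := fun u => s u < t u) (Q := fun u => s u = t u)

/-- The last argument of `R` becomes the argument `0`, and the others are shifted. Unification with
this pattern lets instance search prove the definability of a bounded quantification. -/
instance ball {R : (ℕ → M.Num) → M.Num → Prop} [ht : IsTerm t]
    [hR : IsDelta0 fun u => R (fun i => u (i + 1)) (u 0)] :
    IsDelta0 fun u => ∀ a, a < t u → R u a := by
  obtain ⟨φ, t', V, p, hφ, h⟩ := hR.exists_common_term ht
  have i₁ := varMap_injective bindMap_injective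
  have i₂ := varMap_injective freeMap_injective
  refine ⟨.all (split (.inr 0)) (.imp (.lt (.var (split (.inr 0))) (t'.rename (varMap freeMap)))
    (φ.rename (varMap bindMap) id)), V, scons 0 p, .ball ?_ (hφ.rename i₁ _), fun u => ?_⟩
  · exact not_occurs_rename_freeMap t'
  · simp only [Sat, eval_rename, sat_rename i₁, eval, Function.comp_id, update_join_comp_bindMap,
      update_join_comp_freeMap, h, Function.update_self]
    rfl

instance bex {R : (ℕ → M.Num) → M.Num → Prop} [ht : IsTerm t]
    [hR : IsDelta0 fun u => R (fun i => u (i + 1)) (u 0)] :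
    IsDelta0 fun u => ∃ a, a < t u ∧ R u a :=
  congr (P := fun u => ¬ ∀ a, a < t u → ¬ R u a) fun u => by push Not; rfl

/-- Satisfaction of a bounded formula is definable, as long as the values of its variables are
given by terms. -/
theorem sat {φ : ArithFormula} (hφ : φ.IsBounded) (V : ℕ → M.sets)
    {σ : (ℕ → M.Num) → ℕ → M.Num} (hσ : ∀ i, IsTerm fun u => σ u i) :
    IsDelta0 fun u => M.Sat V (σ u) φ := by
  have key (x : ℕ) {σ : (ℕ → M.Num) → ℕ → M.Num} (hσ : ∀ i, IsTerm fun u => σ u i) (i : ℕ) :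
      IsTerm fun u => Function.update (σ fun i => u (i + 1)) x (u 0) i :=
    .update (σ := fun u => σ fun i => u (i + 1)) (t := fun u => u 0)
      (fun i => IsTerm.comp (f := fun u => σ u i) (σ := fun u i => u (i + 1))) x i
  induction hφ generalizing σ with
  | eq s t =>
    have := IsTerm.eval hσ s
    have := IsTerm.eval hσ t
    exact IsDelta0.eq
  | lt s t =>
    have := IsTerm.eval hσ s
    have := IsTerm.eval hσ t
    exact IsDelta0.lt
  | mem t X =>
    have := IsTerm.eval hσ t
    have : Fact ((V X : Set M.Num) ∈ M.sets) := ⟨(V X).2⟩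
    exact IsDelta0.mem _
  | neg _ ih =>
    have := ih hσ
    exact IsDelta0.not
  | and _ _ ih₁ ih₂ =>
    have := ih₁ hσ
    have := ih₂ hσ
    exact IsDelta0.and
  | or _ _ ih₁ ih₂ =>
    have := ih₁ hσ
    have := ih₂ hσ
    exact IsDelta0.or
  | imp _ _ ih₁ ih₂ =>
    have := ih₁ hσ
    have := ih₂ hσ
    exact IsDelta0.imp
  | @ball x t φ hx _ ih =>
    have := IsTerm.eval hσ t
    have := ih (key x hσ)
    refine congr (P := fun u => ∀ a, a < M.eval (σ u) t →
      M.Sat V (Function.update (σ u) x a) φ) fun u => ?_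
    simp [Sat, eval, eval_update_of_not_occurs hx]
  | @bex x t φ hx _ ih =>
    have := IsTerm.eval hσ t
    have := ih (key x hσ)
    refine congr (P := fun u => ∃ a, a < M.eval (σ u) t ∧
      M.Sat V (Function.update (σ u) x a) φ) fun u => ?_
    simp [Sat, eval, eval_update_of_not_occurs hx]

/-- Substitution of terms for the arguments. -/
theorem comp (hP : IsDelta0 P) {σ : (ℕ → M.Num) → ℕ → M.Num} (hσ : ∀ i, IsTerm fun u => σ u i) :
    IsDelta0 fun u => P (σ u) := by
  obtain ⟨φ, V, p, hφ, h⟩ := hP.exists_formula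
  have := sat hφ V (σ := fun u => join (σ u) p) fun i => by
    unfold join
    rcases split.symm i with j | j
    · exact hσ j
    · exact IsTerm.const _
  exact congr (P := fun u => M.Sat V (join (σ u) p) φ) fun u => h _

/-- Substitution into a predicate in the form required by `ball` and `bex`. -/
theorem comp₂ {R : (ℕ → M.Num) → M.Num → Prop}
    (hR : IsDelta0 fun u => R (fun i => u (i + 1)) (u 0))
    {σ : (ℕ → M.Num) → ℕ → M.Num} (hσ : ∀ i, IsTerm fun u => σ u i) (hs : IsTerm s) :
    IsDelta0 fun u => R (σ u) (s u) :=
  hR.comp (σ := fun u => scons (s u) (σ u)) fun i => by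
    cases i
    · exact hs
    · exact hσ _

end IsDelta0

/-! ### `Σ⁰₁` predicates -/

/-- The predicate `P` is defined by a `Σ⁰₁` formula with parameters. -/
class IsSigma1 (P : (ℕ → M.Num) → Prop) : Prop where
  /-- The matrix `R`, whose last argument is the quantified one. -/
  exists_delta0 : ∃ R : (ℕ → M.Num) → M.Num → Prop,
    IsDelta0 (fun u => R (fun i => u (i + 1)) (u 0)) ∧ ∀ u, P u ↔ ∃ a, R u a

theorem IsSigma1.congr {P Q : (ℕ → M.Num) → Prop} [hP : IsSigma1 P] (h : ∀ u, P u ↔ Q u) :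
    IsSigma1 Q :=
  (funext fun u => propext (h u) : P = Q) ▸ hP

instance IsSigma1.of_isDelta0 {P : (ℕ → M.Num) → Prop} [hP : IsDelta0 P] : IsSigma1 P :=
  ⟨fun u _ => P u, hP.comp fun _ => inferInstance, fun _ => ⟨fun h => ⟨0, h⟩, fun ⟨_, h⟩ => h⟩⟩

theorem IsSigma1.ex_isDelta0 {R : (ℕ → M.Num) → M.Num → Prop}
    [hR : IsDelta0 fun u => R (fun i => u (i + 1)) (u 0)] : IsSigma1 fun u => ∃ a, R u a :=
  ⟨R, hR, fun _ => Iff.rfl⟩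

/-- Two `Σ⁰₁` predicates of one argument, written as `Σ⁰₁` formulas in the variable
`split (.inl 1)` with the same parameters. -/
theorem IsSigma1.exists_formula {P Q : M.Num → Prop} (hP : IsSigma1 fun u => P (u 0))
    (hQ : IsSigma1 fun u => Q (u 0)) :
    ∃ (φ ψ : ArithFormula) (V : ℕ → M.sets) (v : ℕ → M.Num), φ.IsBounded ∧ ψ.IsBounded ∧ ∀ n,
      (P n ↔ ∃ a, M.Sat V (Function.update (Function.update v (split (.inl 1)) n)
        (split (.inl 0)) a) φ) ∧
      (Q n ↔ ∃ a, M.Sat V (Function.update (Function.update v (split (.inl 1)) n)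
        (split (.inl 0)) a) ψ) := by
  obtain ⟨R, hR, hPR⟩ := hP.exists_delta0
  obtain ⟨S, hS, hQS⟩ := hQ.exists_delta0
  obtain ⟨φ, ψ, V, p, hφ, hψ, h⟩ := hR.exists_common hS
  have key (n a : M.Num) :
      (fun i => Function.update (Function.update (fun _ : ℕ => (0 : M.Num)) 1 n) 0 a (i + 1)) =
        Function.update (fun _ : ℕ => (0 : M.Num)) 0 n := by
    funext i
    cases i <;> simp
  refine ⟨φ, ψ, V, join (fun _ => 0) p, hφ, hψ, fun n => ⟨?_, ?_⟩⟩
  · simp only [update_join_inl, h, Function.update_self, key, ← hPR]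
  · simp only [update_join_inl, h, Function.update_self, key, ← hQS]

section Model

variable [hM : Fact M.IsModelRCA0]

theorem induction_sigma1 (P : M.Num → Prop) [hP : IsSigma1 fun u => P (u 0)] (zero : P 0)
    (succ : ∀ n, P n → P (n + 1)) (n : M.Num) : P n := by
  obtain ⟨φ, _, V, v, hφ, _, h⟩ := IsSigma1.exists_formula hP hP
  have := hM.out.sigma1_induction (.ex (split (.inl 0)) φ) ⟨_, _, rfl, hφ⟩ (split (.inl 1)) V v
  simp only [Sat, ← (h _).1] at this
  exact this zero succ n

theorem comprehension_delta1 (P : M.Num → Prop) [hP : IsSigma1 fun u => P (u 0)]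
    [hP' : IsSigma1 fun u => ¬ P (u 0)] : {n | P n} ∈ M.sets := by
  obtain ⟨φ, ψ, V, v, hφ, hψ, h⟩ := IsSigma1.exists_formula (Q := fun n => ¬ P n) hP hP'
  obtain ⟨X, hX, hXP⟩ := hM.out.delta1_comprehension (.ex (split (.inl 0)) φ)
    (.all (split (.inl 0)) (.neg ψ)) ⟨_, _, rfl, hφ⟩ ⟨_, _, rfl, .neg hψ⟩ (split (.inl 1)) V v
    fun n => by
      simp only [Sat, ← (h _).1, ← not_exists, ← (h _).2, not_not]
  have : X = {n | P n} := Set.ext fun n => (hXP n).trans (h n).1.symm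
  exact this ▸ hX

theorem comprehension_delta0 (P : M.Num → Prop) [hP : IsDelta0 fun u => P (u 0)] :
    {n | P n} ∈ M.sets :=
  comprehension_delta1 P

end Model

/-! ### Arithmetic in a model of `RCA₀` -/

section Arithmetic

variable {M : L2Structure.{u}} [hM : Fact M.IsModelRCA0]

namespace Num

theorem succ_ne_zero (a : M.Num) : a + 1 ≠ 0 := hM.out.succ_ne_zero a

theorem succ_inj {a b : M.Num} (h : a + 1 = b + 1) : a = b := hM.out.succ_inj a b h

theorem add_zero (a : M.Num) : a + 0 = a := hM.out.add_zero a

theorem add_succ (a b : M.Num) : a + (b + 1) = a + b + 1 := hM.out.add_succ a b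

theorem mul_zero (a : M.Num) : a * 0 = 0 := hM.out.mul_zero a

theorem mul_succ (a b : M.Num) : a * (b + 1) = a * b + a := hM.out.mul_succ a b

theorem not_lt_zero (a : M.Num) : ¬ a < 0 := hM.out.not_lt_zero a

theorem lt_succ_iff {a b : M.Num} : a < b + 1 ↔ a < b ∨ a = b := hM.out.lt_succ_iff a b

theorem zero_add (a : M.Num) : 0 + a = a :=
  induction_sigma1 (fun a => 0 + a = a) (add_zero 0) (fun n ih => by rw [add_succ, ih]) a

theorem add_assoc (a b c : M.Num) : a + b + c = a + (b + c) :=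
  induction_sigma1 (fun c => a + b + c = a + (b + c)) (by rw [add_zero, add_zero])
    (fun n ih => by rw [add_succ, add_succ, add_succ, ih]) c

theorem one_add (a : M.Num) : 1 + a = a + 1 :=
  induction_sigma1 (fun a => 1 + a = a + 1) (by rw [add_zero, zero_add])
    (fun n ih => by rw [add_succ, ih]) a

theorem add_comm (a b : M.Num) : a + b = b + a :=
  induction_sigma1 (fun b => a + b = b + a) (by rw [add_zero, zero_add])
    (fun n ih => by rw [add_succ, ih, add_assoc, add_assoc, one_add]) b

theorem zero_mul (a : M.Num) : 0 * a = 0 :=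
  induction_sigma1 (fun a => 0 * a = 0) (mul_zero 0)
    (fun n ih => by rw [mul_succ, ih, add_zero]) a

theorem mul_add (a b c : M.Num) : a * (b + c) = a * b + a * c :=
  induction_sigma1 (fun c => a * (b + c) = a * b + a * c) (by rw [add_zero, mul_zero, add_zero])
    (fun n ih => by rw [add_succ, mul_succ, ih, mul_succ, add_assoc]) c

theorem mul_assoc (a b c : M.Num) : a * b * c = a * (b * c) :=
  induction_sigma1 (fun c => a * b * c = a * (b * c)) (by simp only [mul_zero])
    (fun n ih => by rw [mul_succ, ih, mul_succ, mul_add]) c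

theorem one_mul (a : M.Num) : 1 * a = a :=
  induction_sigma1 (fun a => 1 * a = a) (mul_zero 1) (fun n ih => by rw [mul_succ, ih]) a

theorem mul_one (a : M.Num) : a * 1 = a := by
  rw [← zero_add 1, mul_succ, mul_zero, zero_add]

theorem mul_comm (a b : M.Num) : a * b = b * a :=
  induction_sigma1 (fun b => a * b = b * a) (by rw [mul_zero, zero_mul])
    (fun n ih => by
      have key : (n + 1) * a = n * a + a :=
        induction_sigma1 (fun a => (n + 1) * a = n * a + a)
          (by rw [mul_zero, mul_zero, add_zero])
          (fun a ih => by
            rw [mul_succ, ih, mul_succ, add_assoc, add_assoc, ← add_assoc a, add_comm a n,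
              add_assoc n a]) a
      rw [mul_succ, ih, key]) b

instance : CommSemiring M.Num where
  add_assoc := add_assoc
  zero_add := zero_add
  add_zero := add_zero
  add_comm := add_comm
  left_distrib := mul_add
  right_distrib a b c := by rw [mul_comm, mul_add, mul_comm c, mul_comm c]
  zero_mul := zero_mul
  mul_zero := mul_zero
  mul_assoc := mul_assoc
  one_mul := one_mul
  mul_one := mul_one
  mul_comm := mul_comm
  nsmul := nsmulRec

theorem lt_trans {a b c : M.Num} (hab : a < b) (hbc : b < c) : a < c :=
  induction_sigma1 (fun c => b < c → a < c) (fun h => (not_lt_zero _ h).elim)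
    (fun n ih h => lt_succ_iff.2 <| Or.inl <| by
      rcases lt_succ_iff.1 h with h | rfl
      exacts [ih h, hab]) c hbc

theorem lt_add_succ (a b : M.Num) : a < a + b + 1 :=
  induction_sigma1 (fun b => a < a + b + 1) (lt_succ_iff.2 (Or.inr (add_zero a).symm))
    (fun n ih => lt_succ_iff.2 (Or.inl (by rwa [add_succ]))) b

theorem lt_iff_exists_add_succ {a b : M.Num} : a < b ↔ ∃ c, b = a + c + 1 := by
  refine ⟨fun h => ?_, fun ⟨c, hc⟩ => hc ▸ lt_add_succ a c⟩
  have := IsSigma1.ex_isDelta0 (R := fun (u : ℕ → M.Num) c => a < u 0 → u 0 = a + c + 1)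
  obtain ⟨c, hc⟩ := induction_sigma1 (fun b => ∃ c, a < b → b = a + c + 1)
    ⟨0, fun h => (not_lt_zero _ h).elim⟩
    (fun n ⟨c, hc⟩ => by
      by_cases han : a < n
      · exact ⟨c + 1, fun _ => by rw [add_succ, ← hc han]⟩
      · refine ⟨0, fun h => ?_⟩
        rcases lt_succ_iff.1 h with h | rfl
        exacts [(han h).elim, by rw [add_zero]]) b
  exact ⟨c, hc h⟩

theorem add_right_cancel {a b c : M.Num} : a + c = b + c → a = b :=
  induction_sigma1 (fun c => a + c = b + c → a = b) (fun h => by rwa [add_zero, add_zero] at h)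
    (fun n ih h => ih (succ_inj (by rwa [add_succ, add_succ] at h))) c

theorem lt_irrefl (a : M.Num) : ¬ a < a := fun h => by
  obtain ⟨c, hc⟩ := lt_iff_exists_add_succ.1 h
  refine succ_ne_zero c (add_right_cancel (c := a) ?_).symm
  rw [zero_add, add_comm, ← add_assoc, ← hc]

theorem zero_lt_succ (a : M.Num) : 0 < a + 1 := by
  simpa only [zero_add] using lt_add_succ 0 a

theorem zero_le (a : M.Num) : 0 ≤ a :=
  induction_sigma1 (fun a => 0 ≤ a) (Or.inr rfl) (fun n _ => Or.inl (zero_lt_succ n)) a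

theorem succ_lt_succ {a b : M.Num} (h : a < b) : a + 1 < b + 1 := by
  obtain ⟨c, rfl⟩ := lt_iff_exists_add_succ.1 h
  exact lt_iff_exists_add_succ.2 ⟨c, by ring⟩

theorem lt_trichotomy (a b : M.Num) : a < b ∨ a = b ∨ b < a :=
  induction_sigma1 (fun a => a < b ∨ a = b ∨ b < a) (or_assoc.1 (Or.inl (zero_le b)))
    (fun n ih => by
      rcases ih with h | rfl | h
      · obtain ⟨c, rfl⟩ := lt_iff_exists_add_succ.1 h
        rcases zero_le c with hc | rfl
        · exact Or.inl (succ_lt_succ (by obtain ⟨d, rfl⟩ := lt_iff_exists_add_succ.1 hc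
                                         exact lt_iff_exists_add_succ.2 ⟨d, by ring⟩))
        · exact Or.inr (Or.inl (by rw [add_zero]))
      · exact Or.inr (Or.inr (lt_succ_iff.2 (Or.inr rfl)))
      · exact Or.inr (Or.inr (lt_succ_iff.2 (Or.inl h)))) a

noncomputable instance : LinearOrder M.Num where
  le_refl a := Or.inr rfl
  le_trans a b c := by
    rintro (h | rfl) (h' | rfl)
    exacts [Or.inl (lt_trans h h'), Or.inl h, Or.inl h', Or.inr rfl]
  lt_iff_le_not_ge a b := by
    refine ⟨fun h => ⟨Or.inl h, ?_⟩, ?_⟩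
    · rintro (h' | rfl)
      exacts [lt_irrefl _ (lt_trans h h'), lt_irrefl _ h]
    · rintro ⟨h | rfl, h'⟩
      exacts [h, (h' (Or.inr rfl)).elim]
  le_antisymm a b := by
    rintro (h | rfl) (h' | h')
    exacts [(lt_irrefl _ (lt_trans h h')).elim, h'.symm, rfl, rfl]
  le_total a b := by
    rcases lt_trichotomy a b with h | rfl | h
    exacts [Or.inl (Or.inl h), Or.inl (Or.inr rfl), Or.inr (Or.inl h)]
  toDecidableLE := Classical.decRel _

instance : CanonicallyOrderedAdd M.Num where
  exists_add_of_le {a b} h := by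
    rcases h with h | rfl
    · obtain ⟨c, rfl⟩ := lt_iff_exists_add_succ.1 h
      exact ⟨c + 1, add_assoc _ _ _⟩
    · exact ⟨0, (add_zero a).symm⟩
  le_self_add a b := by
    rcases zero_le b with h | rfl
    · obtain ⟨c, rfl⟩ := lt_iff_exists_add_succ.1 h
      exact Or.inl (lt_iff_exists_add_succ.2 ⟨c, by ring⟩)
    · exact Or.inr (add_zero a).symm
  le_add_self a b := by
    rcases zero_le b with h | rfl
    · obtain ⟨c, rfl⟩ := lt_iff_exists_add_succ.1 h
      exact Or.inl (lt_iff_exists_add_succ.2 ⟨c, by ring⟩)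
    · exact Or.inr (zero_add a).symm

theorem add_lt_add_right' {a b : M.Num} (h : a < b) (c : M.Num) : a + c < b + c := by
  obtain ⟨d, rfl⟩ := lt_iff_exists_add_succ.1 h
  exact lt_iff_exists_add_succ.2 ⟨d, by ring⟩

theorem mul_lt_mul_right' {a b : M.Num} (h : a < b) {c : M.Num} (hc : 0 < c) : c * a < c * b := by
  obtain ⟨d, rfl⟩ := lt_iff_exists_add_succ.1 h
  obtain ⟨e, rfl⟩ := lt_iff_exists_add_succ.1 hc
  exact lt_iff_exists_add_succ.2 ⟨d * e + d + e, by ring⟩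

instance : IsStrictOrderedRing M.Num where
  add_le_add_left a b h c := by
    rcases h with h | rfl
    exacts [(add_lt_add_right' h c).le, le_rfl]
  le_of_add_le_add_left a b c h := by
    by_contra! h'
    exact (h.trans_lt (by simpa only [add_comm] using add_lt_add_right' h' a)).false
  zero_le_one := (by simpa only [zero_add] using (zero_lt_succ (M := M) 0).le)
  exists_pair_ne := ⟨0, 1, by simpa only [zero_add] using (succ_ne_zero (0 : M.Num)).symm⟩
  mul_lt_mul_of_pos_left a ha b c h := mul_lt_mul_right' h ha
  mul_lt_mul_of_pos_right a ha b c h := by simpa only [mul_comm] using mul_lt_mul_right' h ha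

end Num

theorem lt_add_one_iff {a b : M.Num} : a < b + 1 ↔ a ≤ b := Num.lt_succ_iff

theorem lt_iff_add_one_le {a b : M.Num} : a < b ↔ a + 1 ≤ b := by
  rw [← lt_add_one_iff]
  exact (add_lt_add_iff_right 1).symm

theorem eq_zero_or_exists_add_one (a : M.Num) : a = 0 ∨ ∃ b, a = b + 1 := by
  rcases Num.zero_le a with h | rfl
  · obtain ⟨c, hc⟩ := Num.lt_iff_exists_add_succ.1 h
    exact Or.inr ⟨c, by rw [hc, zero_add]⟩
  · exact Or.inl rfl

theorem left_le_pair (x y : M.Num) : x ≤ pair x y := by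
  unfold pair
  exact le_add_self

theorem le_sq (x : M.Num) : x ≤ x * x := by
  obtain rfl | ⟨y, rfl⟩ := eq_zero_or_exists_add_one x
  · exact Num.zero_le _
  · exact le_iff_exists_add.2 ⟨y * (y + 1), by ring⟩

theorem right_le_pair (x y : M.Num) : y ≤ pair x y := by
  unfold pair
  exact le_add_self.trans ((le_sq (x + y)).trans le_self_add)

/-- Pairs are compared by their sums first, since `s² + x < (s + 1)²` for `x ≤ s`. -/
theorem pair_inj {x y x' y' : M.Num} : pair x y = pair x' y' ↔ x = x' ∧ y = y' := by
  have key {x y x' y' : M.Num} (h : pair x y = pair x' y') : ¬ x + y < x' + y' := fun hlt => by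
    obtain ⟨c, hc⟩ := Num.lt_iff_exists_add_succ.1 hlt
    have : pair x y < pair x' y' := by
      unfold pair
      rw [hc]
      exact Num.lt_iff_exists_add_succ.2
        ⟨x + 2 * y + 2 * (x + y) * c + c * c + 2 * c + x', by ring⟩
    exact this.ne h
  refine ⟨fun h => ?_, fun ⟨h, h'⟩ => h ▸ h' ▸ rfl⟩
  have hs : x + y = x' + y' := le_antisymm (not_lt.1 (key h.symm)) (not_lt.1 (key h))
  unfold pair at h
  rw [hs] at h
  have hx := add_left_cancel h
  subst hx
  exact ⟨rfl, add_left_cancel hs⟩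

end Arithmetic

section Definability

variable {M : L2Structure.{u}} [hM : Fact M.IsModelRCA0]

/-! ### Closure properties of `Σ⁰₁` predicates -/

namespace IsSigma1

variable {P Q : (ℕ → M.Num) → Prop}

instance and [hP : IsSigma1 P] [hQ : IsSigma1 Q] : IsSigma1 fun u => P u ∧ Q u := by
  obtain ⟨R, hR, hPR⟩ := hP.exists_delta0
  obtain ⟨S, hS, hQS⟩ := hQ.exists_delta0
  have (σ : (ℕ → M.Num) → ℕ → M.Num) (s) [hσ : ∀ i, IsTerm fun u => σ u i] [hs : IsTerm s] :=
    hR.comp₂ hσ hs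
  have (σ : (ℕ → M.Num) → ℕ → M.Num) (s) [hσ : ∀ i, IsTerm fun u => σ u i] [hs : IsTerm s] :=
    hS.comp₂ hσ hs
  refine ⟨fun u c => (∃ a, a < c ∧ R u a) ∧ (∃ b, b < c ∧ S u b), inferInstance, fun u => ?_⟩
  rw [hPR, hQS]
  refine ⟨fun ⟨⟨a, ha⟩, b, hb⟩ => ⟨a + b + 1, ⟨a, lt_add_one_iff.2 le_self_add, ha⟩,
    b, lt_add_one_iff.2 le_add_self, hb⟩, fun ⟨_, ⟨a, _, ha⟩, b, _, hb⟩ => ⟨⟨a, ha⟩, b, hb⟩⟩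

instance or [hP : IsSigma1 P] [hQ : IsSigma1 Q] : IsSigma1 fun u => P u ∨ Q u := by
  obtain ⟨R, hR, hPR⟩ := hP.exists_delta0
  obtain ⟨S, hS, hQS⟩ := hQ.exists_delta0
  refine ⟨fun u c => R u c ∨ S u c, inferInstance, fun u => ?_⟩
  rw [hPR, hQS, exists_or]

instance ex {R : (ℕ → M.Num) → M.Num → Prop}
    [hR : IsSigma1 fun u => R (fun i => u (i + 1)) (u 0)] : IsSigma1 fun u => ∃ a, R u a := by
  obtain ⟨S, hS, hRS⟩ := hR.exists_delta0
  have key (u : ℕ → M.Num) (a : M.Num) : R u a ↔ ∃ b, S (scons a u) b := hRS (scons a u)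
  refine ⟨fun u c => ∃ a, a < c ∧ ∃ b, b < c ∧ S (scons a u) b, ?_, fun u => ?_⟩
  · -- The arguments `0`, `1`, `2` are `b`, `a`, `c`.
    have := hS.comp₂ (σ := fun u => scons (u 1) fun i => u (i + 3)) (s := fun u => u 0)
      (fun i => by cases i <;> exact IsTerm.var _) inferInstance
    exact inferInstance
  · simp only [key]
    refine ⟨fun ⟨a, b, h⟩ => ⟨a + b + 1, a, lt_add_one_iff.2 le_self_add,
      b, lt_add_one_iff.2 le_add_self, h⟩, fun ⟨_, a, _, b, _, h⟩ => ⟨a, b, h⟩⟩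

end IsSigma1

instance IsDelta0.dvd {s t : (ℕ → M.Num) → M.Num} [hs : IsTerm s] [ht : IsTerm t] :
    IsDelta0 fun u => s u ∣ t u :=
  congr (P := fun u => ∃ k, k < t u + 1 ∧ t u = s u * k) fun u => by
    refine ⟨fun ⟨k, _, hk⟩ => ⟨k, hk⟩, fun ⟨k, hk⟩ => ?_⟩
    rcases eq_zero_or_exists_add_one (s u) with h | ⟨e, he⟩
    · exact ⟨0, Num.zero_lt_succ _, by simp [hk, h]⟩
    · exact ⟨k, lt_add_one_iff.2 (by rw [hk, he]; exact le_iff_exists_add.2 ⟨e * k, by ring⟩), hk⟩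

/-! ### Least elements and bounding -/

theorem exists_least (P : M.Num → Prop) [hP : IsDelta0 fun u => P (u 0)] {n : M.Num} (hn : P n) :
    ∃ m, P m ∧ ∀ k < m, ¬ P k := by
  by_contra! h
  have key : ∀ n : M.Num, ∀ k, k < n → ¬ P k := fun n =>
    induction_sigma1 (fun n => ∀ k, k < n → ¬ P k) (fun k hk => (Num.not_lt_zero k hk).elim)
      (fun n ih k hk hPk => by
        obtain ⟨j, hj, hPj⟩ := h k hPk
        exact ih j (hj.trans_le (lt_add_one_iff.1 hk)) hPj) n
  exact key (n + 1) n (lt_add_one_iff.2 le_rfl) hn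

/-- The bounding principle for `Σ⁰₀` predicates. -/
theorem exists_bound (P : M.Num → M.Num → Prop) [hP : IsDelta0 fun u => P (u 1) (u 0)] {a : M.Num}
    (h : ∀ x < a, ∃ y, P x y) : ∃ b, ∀ x < a, ∃ y, y < b ∧ P x y := by
  obtain ⟨b, hb⟩ := induction_sigma1 (fun k => ∃ b, ∀ x, x < k → x < a → ∃ y, y < b ∧ P x y)
    ⟨0, fun x hx => (Num.not_lt_zero x hx).elim⟩
    (fun n ⟨b, hb⟩ => by
      by_cases hn : n < a
      · obtain ⟨y, hy⟩ := h n hn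
        refine ⟨b + y + 1, fun x hx hxa => ?_⟩
        rcases Num.lt_succ_iff.1 hx with hx | rfl
        · obtain ⟨z, hz, hPz⟩ := hb x hx hxa
          exact ⟨z, hz.trans (Num.lt_add_succ b y), hPz⟩
        · exact ⟨y, lt_add_one_iff.2 le_add_self, hy⟩
      · refine ⟨b, fun x hx hxa => ?_⟩
        rcases Num.lt_succ_iff.1 hx with hx | rfl
        exacts [hb x hx hxa, (hn hxa).elim]) a
  exact ⟨b, fun x hx => hb x hx hx⟩

/-! ### Codes for finite sets -/

/-- The common multiple serves as the base of the codes for sets of numbers below `N`. -/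
theorem exists_common_multiple (N : M.Num) : ∃ d : M.Num, 0 < d ∧ ∀ e < N, e + 1 ∣ d := by
  refine induction_sigma1 (fun N => ∃ d : M.Num, 0 < d ∧ ∀ e, e < N → e + 1 ∣ d)
    ⟨1, zero_lt_one, fun e he => (Num.not_lt_zero e he).elim⟩ (fun N ⟨d, hd, h⟩ => ?_) N
  refine ⟨d * (N + 1), mul_pos hd (Num.zero_lt_succ N), fun e he => ?_⟩
  rcases Num.lt_succ_iff.1 he with he | rfl
  exacts [(h e he).mul_right _, dvd_mul_left _ _]

/-- Subtraction is not available in `M.Num`, so this does not follow from the ring lemmas. -/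
theorem dvd_of_dvd_add {a b c : M.Num} (h : a ∣ b + c) (hc : a ∣ c) : a ∣ b := by
  obtain ⟨s, hs⟩ := h
  obtain ⟨t, rfl⟩ := hc
  rcases lt_or_ge s t with hst | hst
  · obtain ⟨e, rfl⟩ := Num.lt_iff_exists_add_succ.1 hst
    have : b + a * (e + 1) = 0 := Num.add_right_cancel (c := a * s) (by
      rw [zero_add]
      exact .trans (by ring) hs)
    rw [_root_.add_eq_zero] at this
    exact this.1 ▸ dvd_zero a
  · obtain ⟨r, rfl⟩ := exists_add_of_le hst
    exact ⟨r, Num.add_right_cancel (c := a * t) (by rw [hs]; ring)⟩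

/-- The factor `1 + (x + 1) d` of a code with base `d` signals that `x` is an element. Euclid's
lemma holds for such factors, because `d` is a linear combination of them. -/
theorem dvd_of_dvd_mul_factor {N d x y c : M.Num} (hd : ∀ e < N, e + 1 ∣ d) (hx : x < N)
    (hy : y < N) (hxy : x ≠ y) (h : 1 + (x + 1) * d ∣ c * (1 + (y + 1) * d)) :
    1 + (x + 1) * d ∣ c := by
  -- It suffices to divide `c * d`, since `c = c * (1 + (x + 1) * d) - (x + 1) * (c * d)`.
  have key : 1 + (x + 1) * d ∣ c * d → 1 + (x + 1) * d ∣ c := fun h' => by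
    refine dvd_of_dvd_add (c := (x + 1) * (c * d)) ⟨c, by ring⟩ (h'.mul_left _)
  apply key
  -- With `u` and `v` the factors of `x` and `y`, `(y + 1) * u - (x + 1) * v = y - x`, which
  -- divides `d`.
  rcases lt_or_gt_of_ne hxy with hlt | hlt
  · obtain ⟨e, rfl⟩ := Num.lt_iff_exists_add_succ.1 hlt
    obtain ⟨m, hm⟩ := hd e (lt_of_le_of_lt (le_add_self.trans le_self_add) ‹_ + e + 1 < N›)
    refine dvd_of_dvd_add (c := m * (x + 1) * (c * (1 + (x + e + 1 + 1) * d)))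
      ⟨c * m * (x + e + 1 + 1), ?_⟩ (h.mul_left _)
    nth_rewrite 1 [hm]
    ring
  · obtain ⟨e, rfl⟩ := Num.lt_iff_exists_add_succ.1 hlt
    obtain ⟨m, hm⟩ := hd e (lt_of_le_of_lt (le_add_self.trans le_self_add) ‹_ + e + 1 < N›)
    refine dvd_of_dvd_add (c := c * m * (y + 1) * (1 + (y + e + 1 + 1) * d)) ?_ (dvd_mul_left _ _)
    refine (h.mul_left (m * (y + e + 1 + 1))).trans (dvd_of_eq ?_)
    nth_rewrite 2 [hm]
    ring

/-- `x` is an element of the finite set with code `(c, d, N)`. -/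
def InCode (c d N x : M.Num) : Prop := x < N ∧ 1 + (x + 1) * d ∣ c

instance {c d N x : (ℕ → M.Num) → M.Num} [IsTerm c] [IsTerm d] [IsTerm N] [IsTerm x] :
    IsDelta0 fun u => InCode (c u) (d u) (N u) (x u) := by
  unfold InCode
  infer_instance

/-- Bounded comprehension for `Σ⁰₀` predicates, with numbers as codes. -/
theorem exists_code (P : M.Num → Prop) [hP : IsDelta0 fun u => P (u 0)] (N : M.Num) :
    ∃ c d, ∀ x, InCode c d N x ↔ x < N ∧ P x := by
  obtain ⟨d, hd₀, hd⟩ := exists_common_multiple N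
  have key : ∀ y, ∃ c, ∀ x, x < N → (1 + (x + 1) * d ∣ c ↔ P x ∧ x < y) := by
    refine induction_sigma1 (fun y => ∃ c, ∀ x, x < N → (1 + (x + 1) * d ∣ c ↔ P x ∧ x < y))
      ⟨1, fun x hx => ?_⟩ fun y ih => ?_
    · refine iff_of_false (fun h => ?_) fun h => Num.not_lt_zero x h.2
      have : 0 < (x + 1) * d := mul_pos (Num.zero_lt_succ x) hd₀
      obtain ⟨k, hk⟩ := h
      obtain rfl | ⟨j, rfl⟩ := eq_zero_or_exists_add_one k
      · simp at hk
      · refine (lt_add_of_pos_right 1 this).not_ge ?_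
        conv_rhs => rw [hk]
        exact le_mul_of_one_le_right' le_add_self
    · obtain ⟨c, hc⟩ := ih
      by_cases hy : P y ∧ y < N
      · refine ⟨c * (1 + (y + 1) * d), fun x hx => ?_⟩
        by_cases hxy : x = y
        · subst hxy
          exact iff_of_true (dvd_mul_left _ _) ⟨hy.1, lt_add_one_iff.2 le_rfl⟩
        · rw [lt_add_one_iff, le_iff_lt_or_eq, or_iff_left hxy, ← hc x hx]
          exact ⟨dvd_of_dvd_mul_factor hd hx hy.2 hxy, fun h => h.mul_right _⟩
      · refine ⟨c, fun x hx => ?_⟩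
        rw [hc x hx, lt_add_one_iff, le_iff_lt_or_eq]
        grind
  obtain ⟨c, hc⟩ := key N
  exact ⟨c, d, fun x => and_congr_right fun hx => (hc x hx).trans (and_iff_left hx)⟩

/-! ### Functions -/

/-- The set of pairs `(x, y)` with `P x y`. -/
def graph (P : M.Num → M.Num → Prop) : Set M.Num := {z | ∃ x y, z = pair x y ∧ P x y}

theorem pair_mem_graph {P : M.Num → M.Num → Prop} {x y : M.Num} : pair x y ∈ graph P ↔ P x y := by
  refine ⟨fun ⟨x', y', h, hP⟩ => ?_, fun h => ⟨x, y, rfl, h⟩⟩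
  obtain ⟨rfl, rfl⟩ := pair_inj.1 h
  exact hP

/-- The graph of a total `Σ⁰₁` function is a set of the model: two values are distinct if and only
if the first is not the value at its argument, so the graph is `Δ⁰₁`. -/
theorem isFun_graph (P : M.Num → M.Num → Prop)
    [hP : ∀ (s t : (ℕ → M.Num) → M.Num) [IsTerm s] [IsTerm t], IsSigma1 fun u => P (s u) (t u)]
    {A : Set M.Num} (total : ∀ x, ∃ y ∈ A, P x y) (unique : ∀ x y z, P x y → P x z → y = z) :
    IsFun (graph P) A := by
  refine ⟨?_, fun z ⟨x, y, h, _⟩ => ⟨x, y, h⟩, fun x => ?_, fun x y z => ?_⟩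
  · have : IsSigma1 fun u : ℕ → M.Num => ¬ ∃ x y, u 0 = pair x y ∧ P x y :=
      IsSigma1.congr (P := fun u => (∀ x, x < u 0 + 1 → ∀ y, y < u 0 + 1 → ¬ u 0 = pair x y) ∨
        ∃ x y z, u 0 = pair x y ∧ ¬ y = z ∧ P x z) fun u => by
        constructor
        · rintro (h | ⟨x, y, z, h, hyz, hP⟩) ⟨x', y', h', hP'⟩
          · exact h x' (lt_add_one_iff.2 (h' ▸ left_le_pair x' y'))
              y' (lt_add_one_iff.2 (h' ▸ right_le_pair x' y')) h'
          · obtain ⟨rfl, rfl⟩ := pair_inj.1 (h.symm.trans h')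
            exact hyz (unique _ _ _ hP' hP)
        · intro h
          by_contra! h'
          obtain ⟨⟨x, _, y, _, hxy⟩, h'⟩ := h'
          obtain ⟨z, _, hz⟩ := total x
          by_cases hyz : y = z
          · exact h ⟨x, y, hxy, hyz ▸ hz⟩
          · exact h' x y z hxy hyz hz
    exact comprehension_delta1 fun z => ∃ x y, z = pair x y ∧ P x y
  · obtain ⟨y, hy, h⟩ := total x
    exact ⟨y, hy, pair_mem_graph.2 h⟩
  · simp only [pair_mem_graph]
    exact unique x y z

/-- The finite set with code `(c, d, N)` is closed under predecessors in the iteration of `H` from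
`a`: it contains a pair `(i, y)` only if `y` is the `i`-th iterate. -/
def IsTrace (H : M.Num → M.Num → Prop) (a c d N : M.Num) : Prop :=
  ∀ i, i < N → ∀ y, y < N → InCode c d N (pair i y) → (i = 0 ∧ y = a) ∨
    ∃ j, j < N ∧ ∃ x, x < N ∧ i = j + 1 ∧ InCode c d N (pair j x) ∧ H x y

/-- Iteration of a total `Σ⁰₀` function `H`. The graph of the iteration is `Σ⁰₁`, because every
iterate is witnessed by the code of a trace. The definability of `H` is assumed in a form that is
closed under substitution. -/
theorem exists_iterates (H : M.Num → M.Num → Prop)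
    [hH : ∀ (s t : (ℕ → M.Num) → M.Num) [IsTerm s] [IsTerm t], IsDelta0 fun u => H (s u) (t u)]
    (total : ∀ x, ∃ y, H x y) (unique : ∀ x y z, H x y → H x z → y = z) (a : M.Num) :
    ∃ G : Set M.Num, IsFun G Set.univ ∧ pair 0 a ∈ G ∧
      ∀ k x y, pair k x ∈ G → pair (k + 1) y ∈ G → H x y := by
  -- `P k y` says that `y` is the `k`-th iterate.
  let P (k y : M.Num) : Prop := ∃ c d N, IsTrace H a c d N ∧ InCode c d N (pair k y)
  have hP (s t : (ℕ → M.Num) → M.Num) [hs : IsTerm s] [ht : IsTerm t] :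
      IsSigma1 fun u => P (s u) (t u) := by
    simp only [P, IsTrace]
    infer_instance
  have bound {c d N k y : M.Num} (h : InCode c d N (pair k y)) : k < N ∧ y < N :=
    ⟨(left_le_pair k y).trans_lt h.1, (right_le_pair k y).trans_lt h.1⟩
  have trace {c d N i y : M.Num} (hT : IsTrace H a c d N) (h : InCode c d N (pair i y)) :
      (i = 0 ∧ y = a) ∨ ∃ j x, i = j + 1 ∧ InCode c d N (pair j x) ∧ H x y := by
    rcases hT i (bound h).1 y (bound h).2 h with h | ⟨j, _, x, _, h⟩
    exacts [Or.inl h, Or.inr ⟨j, x, h⟩]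
  have zero : P 0 a := by
    obtain ⟨c, d, h⟩ := exists_code (fun x => x = pair 0 a) (pair 0 a + 1)
    exact ⟨c, d, _, fun i _ y _ h' => Or.inl (pair_inj.1 ((h _).1 h').2),
      (h _).2 ⟨lt_add_one_iff.2 le_rfl, rfl⟩⟩
  have total' (k : M.Num) : ∃ y, P k y := by
    refine induction_sigma1 (fun k => ∃ y, P k y) ⟨a, zero⟩ (fun k ih => ?_) k
    obtain ⟨x, c, d, N, hT, hx⟩ := ih
    obtain ⟨y, hy⟩ := total x
    obtain ⟨c', d', h⟩ := exists_code (fun z => InCode c d N z ∨ z = pair (k + 1) y)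
      (N + pair (k + 1) y + 1)
    have old {z : M.Num} (hz : InCode c d N z) : InCode c' d' (N + pair (k + 1) y + 1) z :=
      (h z).2 ⟨hz.1.trans (Num.lt_add_succ _ _), Or.inl hz⟩
    refine ⟨y, c', d', _, fun i _ z _ hz => ?_,
      (h _).2 ⟨lt_add_one_iff.2 le_add_self, Or.inr rfl⟩⟩
    rcases ((h _).1 hz).2 with hz | hz
    · rcases trace hT hz with hz | ⟨j, w, hi, hw, hH⟩
      · exact Or.inl hz
      · exact Or.inr ⟨j, (bound (old hw)).1, w, (bound (old hw)).2, hi, old hw, hH⟩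
    · obtain ⟨rfl, rfl⟩ := pair_inj.1 hz
      exact Or.inr ⟨k, (bound (old hx)).1, x, (bound (old hx)).2, rfl, old hx, hy⟩
  have unique' (k y z : M.Num) : P k y → P k z → y = z := by
    rintro ⟨c, d, N, hT, hy⟩ ⟨c', d', N', hT', hz⟩
    refine induction_sigma1 (fun k => ∀ y, y < N → ∀ z, z < N' → InCode c d N (pair k y) →
      InCode c' d' N' (pair k z) → y = z) (fun y _ z _ hy hz => ?_)
      (fun k ih y _ z _ hy hz => ?_) k y (bound hy).2 z (bound hz).2 hy hz
    · rcases trace hT hy with ⟨_, rfl⟩ | ⟨j, x, h, _⟩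
      · rcases trace hT' hz with ⟨_, rfl⟩ | ⟨j, x, h, _⟩
        exacts [rfl, (Num.succ_ne_zero j h.symm).elim]
      · exact (Num.succ_ne_zero j h.symm).elim
    · rcases trace hT hy with ⟨h, _⟩ | ⟨j, x, h, hx, hxy⟩
      · exact (Num.succ_ne_zero k h).elim
      · rcases trace hT' hz with ⟨h, _⟩ | ⟨j', x', h', hx', hxz⟩
        · exact (Num.succ_ne_zero k h).elim
        · obtain rfl := Num.succ_inj h
          obtain rfl := Num.succ_inj h'
          obtain rfl := ih x (bound hx).2 x' (bound hx').2 hx hx'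
          exact unique _ _ _ hxy hxz
  have hG : IsFun (graph P) Set.univ := isFun_graph P (hP := hP)
    (fun k => (total' k).imp fun y hy => ⟨trivial, hy⟩) unique'
  refine ⟨graph P, hG, pair_mem_graph.2 zero, fun k x y hx hy => ?_⟩
  obtain ⟨c, d, N, hT, hy⟩ := pair_mem_graph.1 hy
  rcases trace hT hy with ⟨h, _⟩ | ⟨j, w, h, hw, hwy⟩
  · exact (Num.succ_ne_zero k h).elim
  · obtain rfl := Num.succ_inj h
    exact unique' k x w (pair_mem_graph.1 hx) ⟨c, d, N, hT, hw⟩ ▸ hwy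

end Definability

/-! ### Orders on copies of a quasi-order -/

section Copies

variable {M : L2Structure.{u}} [hM : Fact M.IsModelRCA0]

theorem graph_mem_sets (P : M.Num → M.Num → Prop)
    [hP : ∀ (s t : (ℕ → M.Num) → M.Num) [IsTerm s] [IsTerm t], IsDelta0 fun u => P (s u) (t u)] :
    graph P ∈ M.sets := by
  have := comprehension_delta0 fun z : M.Num =>
    ∃ x, x < z + 1 ∧ ∃ y, y < z + 1 ∧ z = pair x y ∧ P x y
  convert this using 1
  ext z
  refine ⟨fun ⟨x, y, h, hP⟩ => ?_, fun ⟨x, _, y, _, h⟩ => ⟨x, y, h⟩⟩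
  exact ⟨x, lt_add_one_iff.2 (h ▸ left_le_pair x y), y, lt_add_one_iff.2 (h ▸ right_le_pair x y),
    h, hP⟩

/-- The order on `n × Q` that compares first components by `S` and second components by `R`. -/
def copiesOrder (S : M.Num → M.Num → Prop) (n : M.Num) (Q R : Set M.Num) : Set M.Num :=
  {z | ∃ m₁ m₂ q₁ q₂ : M.Num, m₁ < n ∧ m₂ < n ∧ q₁ ∈ Q ∧ q₂ ∈ Q ∧
    (S m₁ m₂ ∧ pair q₁ q₂ ∈ R) ∧ z = pair (pair m₁ q₁) (pair m₂ q₂)}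

theorem pair_mem_copies {n m q : M.Num} {Q : Set M.Num} :
    pair m q ∈ copies n Q ↔ m < n ∧ q ∈ Q := by
  refine ⟨fun ⟨m', q', hm, hq, h⟩ => ?_, fun h => ⟨m, q, h.1, h.2, rfl⟩⟩
  obtain ⟨rfl, rfl⟩ := pair_inj.1 h
  exact ⟨hm, hq⟩

theorem pair_mem_copiesOrder {S : M.Num → M.Num → Prop} {n m₁ m₂ q₁ q₂ : M.Num} {Q R : Set M.Num} :
    pair (pair m₁ q₁) (pair m₂ q₂) ∈ copiesOrder S n Q R ↔
      m₁ < n ∧ m₂ < n ∧ q₁ ∈ Q ∧ q₂ ∈ Q ∧ S m₁ m₂ ∧ pair q₁ q₂ ∈ R := by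
  refine ⟨fun ⟨m₁', m₂', q₁', q₂', h₁, h₂, h₃, h₄, h₅, h⟩ => ?_,
    fun ⟨h₁, h₂, h₃, h₄, h₅⟩ => ⟨m₁, m₂, q₁, q₂, h₁, h₂, h₃, h₄, h₅, rfl⟩⟩
  obtain ⟨h, h'⟩ := pair_inj.1 h
  obtain ⟨rfl, rfl⟩ := pair_inj.1 h
  obtain ⟨rfl, rfl⟩ := pair_inj.1 h'
  exact ⟨h₁, h₂, h₃, h₄, h₅⟩

theorem IsQuasiOrder.copiesOrder {S : M.Num → M.Num → Prop}
    [hS : ∀ (s t : (ℕ → M.Num) → M.Num) [IsTerm s] [IsTerm t], IsDelta0 fun u => S (s u) (t u)]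
    (refl : ∀ m, S m m) (trans : ∀ l m n, S l m → S m n → S l n) {Q R : Set M.Num}
    (h : IsQuasiOrder Q R) (n : M.Num) : IsQuasiOrder (copies n Q) (copiesOrder S n Q R) := by
  obtain ⟨hQ, hR, -, hrefl, htrans⟩ := h
  have : Fact (Q ∈ M.sets) := ⟨hQ⟩
  have : Fact (R ∈ M.sets) := ⟨hR⟩
  refine ⟨?_, ?_, ?_, ?_, ?_⟩
  · refine (Set.ext fun z => ?_ : _ = copies n Q) ▸
      graph_mem_sets (hP := fun _ _ _ _ => inferInstance) fun m q => m < n ∧ q ∈ Q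
    exact ⟨fun ⟨m, q, hz, hm, hq⟩ => ⟨m, q, hm, hq, hz⟩,
      fun ⟨m, q, hm, hq, hz⟩ => ⟨m, q, hz, hm, hq⟩⟩
  · have key := graph_mem_sets (M := M) (hP := fun _ _ _ _ => inferInstance) fun a b =>
      ∃ m₁, m₁ < a + 1 ∧ ∃ q₁, q₁ < a + 1 ∧ ∃ m₂, m₂ < b + 1 ∧ ∃ q₂, q₂ < b + 1 ∧
        a = pair m₁ q₁ ∧ b = pair m₂ q₂ ∧ m₁ < n ∧ m₂ < n ∧ q₁ ∈ Q ∧ q₂ ∈ Q ∧ S m₁ m₂ ∧ pair q₁ q₂ ∈ R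
    refine (Set.ext fun z => ⟨?_, ?_⟩ : _ = L2Structure.copiesOrder S n Q R) ▸ key
    · rintro ⟨_, _, hz, m₁, _, q₁, _, m₂, _, q₂, _, rfl, rfl, h₁, h₂, h₃, h₄, h₅⟩
      exact ⟨m₁, m₂, q₁, q₂, h₁, h₂, h₃, h₄, h₅, hz⟩
    · rintro ⟨m₁, m₂, q₁, q₂, h₁, h₂, h₃, h₄, h₅, hz⟩
      exact ⟨_, _, hz, m₁, lt_add_one_iff.2 (left_le_pair _ _), q₁,
        lt_add_one_iff.2 (right_le_pair _ _), m₂, lt_add_one_iff.2 (left_le_pair _ _), q₂,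
        lt_add_one_iff.2 (right_le_pair _ _), rfl, rfl, h₁, h₂, h₃, h₄, h₅⟩
  · rintro z ⟨m₁, m₂, q₁, q₂, h₁, h₂, h₃, h₄, h₅, hz⟩
    exact ⟨_, pair_mem_copies.2 ⟨h₁, h₃⟩, _, pair_mem_copies.2 ⟨h₂, h₄⟩, hz⟩
  · rintro _ ⟨m, q, hm, hq, rfl⟩
    exact pair_mem_copiesOrder.2 ⟨hm, hm, hq, hq, refl m, hrefl q hq⟩
  · rintro _ ⟨m₁, q₁, -, -, rfl⟩ _ ⟨m₂, q₂, -, -, rfl⟩ _ ⟨m₃, q₃, -, -, rfl⟩ h h'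
    obtain ⟨h₁, h₂, h₃, h₄, hS, hR⟩ := pair_mem_copiesOrder.1 h
    obtain ⟨-, h₅, -, h₆, hS', hR'⟩ := pair_mem_copiesOrder.1 h'
    exact pair_mem_copiesOrder.2 ⟨h₁, h₅, h₃, h₆, trans _ _ _ hS hS',
      htrans _ h₃ _ h₄ _ h₆ hR hR'⟩

theorem WQPDisjointUnion.wqpProductOrder (h : M.WQPDisjointUnion) : M.WQPProductOrder := by
  intro n Q R hQ
  refine ⟨hQ.1.copiesOrder (S := fun a b => a ≤ b) (hS := fun _ _ _ _ => inferInstance)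
    (fun _ => le_rfl) (fun _ _ _ => le_trans) n, fun F hF => ?_⟩
  obtain ⟨i, j, p, q, hij, hp, hq, m₁, m₂, q₁, q₂, h₁, h₂, h₃, h₄, ⟨h₅, h₆⟩, h₇⟩ :=
    (h n Q R hQ).2 F hF
  exact ⟨i, j, p, q, hij, hp, hq, m₁, m₂, q₁, q₂, h₁, h₂, h₃, h₄, ⟨Or.inr h₅, h₆⟩, h₇⟩

end Copies

/-! ### The pigeonhole principle from the product order -/

section ColourOrder

variable {M : L2Structure.{u}}

theorem IsFun.mem {F A : Set M.Num} (hF : IsFun F A) {i a : M.Num}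
    (h : pair i a ∈ F) : a ∈ A := by
  obtain ⟨b, hb, h'⟩ := hF.2.2.1 i
  exact hF.2.2.2 _ _ _ h h' ▸ hb

/-- The lexicographic order given by the colouring with graph `F`: `p` is below `q` if `q` has a
smaller colour, or has the same colour and `q ≤ p`. -/
def colourOrder (F : Set M.Num) (n : M.Num) (p q : M.Num) : Prop :=
  ∃ a, a < n ∧ ∃ b, b < n ∧ pair p a ∈ F ∧ pair q b ∈ F ∧ (b < a ∨ a = b ∧ q ≤ p)

theorem colourOrder_iff {F : Set M.Num} {n p q a b : M.Num} (hF : IsFun F {m | m < n})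
    (ha : pair p a ∈ F) (hb : pair q b ∈ F) :
    colourOrder F n p q ↔ b < a ∨ a = b ∧ q ≤ p := by
  refine ⟨fun ⟨a', _, b', _, ha', hb', h⟩ => ?_, fun h => ⟨a, hF.mem ha, b, hF.mem hb, ha, hb, h⟩⟩
  obtain rfl := hF.2.2.2 _ _ _ ha ha'
  obtain rfl := hF.2.2.2 _ _ _ hb hb'
  exact h

end ColourOrder

section Principles

variable {M : L2Structure.{u}} [hM : Fact M.IsModelRCA0]

/-- A sequence that is bad for `colourOrder` has weakly increasing colours. They stabilize at the
greatest colour that occurs, and from there on the sequence is strictly increasing. -/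
theorem exists_infinite_of_bad {F G : Set M.Num} {n : M.Num} (hF : IsFun F {m | m < n})
    (hG : IsFun G Set.univ)
    (bad : ∀ i j p q, i < j → pair i p ∈ G → pair j q ∈ G → ¬ colourOrder F n p q) :
    ∃ m, ∀ k, ∃ j, k < j ∧ pair j m ∈ F := by
  have : Fact (F ∈ M.sets) := ⟨hF.1⟩
  have : Fact (G ∈ M.sets) := ⟨hG.1⟩
  -- The greatest colour `m` of the sequence exists by `Σ⁰₁` induction.
  obtain ⟨m, ⟨k₀, y₀, m₀, hk₀, hy₀, hm₀⟩, hmax⟩ :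
      ∃ m, (∃ k y m', pair k y ∈ G ∧ pair y m' ∈ F ∧ m ≤ m') ∧
        ¬ ∃ k y m', pair k y ∈ G ∧ pair y m' ∈ F ∧ m + 1 ≤ m' := by
    by_contra! h
    obtain ⟨y₀, -, hy₀⟩ := hG.2.2.1 0
    obtain ⟨m₀, -, hm₀⟩ := hF.2.2.1 y₀
    obtain ⟨k, y, m, -, hm, hn⟩ := induction_sigma1
      (fun m => ∃ k y m', pair k y ∈ G ∧ pair y m' ∈ F ∧ m ≤ m')
      ⟨0, y₀, m₀, hy₀, hm₀, Num.zero_le _⟩ (fun m hm => h m hm) n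
    exact hn.not_gt (hF.mem hm)
  have stable {k y : M.Num} (hk : k₀ ≤ k) (hy : pair k y ∈ G) : pair y m ∈ F := by
    obtain ⟨m', -, hm'⟩ := hF.2.2.1 y
    have le : m' ≤ m := not_lt.1 fun h => hmax ⟨k, y, m', hy, hm', lt_iff_add_one_le.1 h⟩
    have ge : m ≤ m' := by
      rcases hk.eq_or_lt with rfl | hk
      · obtain rfl := hG.2.2.2 _ _ _ hy hk₀
        exact hF.2.2.2 _ _ _ hm' hy₀ ▸ hm₀
      · by_contra! h
        exact bad _ _ _ _ hk hk₀ hy ((colourOrder_iff hF hy₀ hm').2 (Or.inl (h.trans_le hm₀)))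
    exact le_antisymm le ge ▸ hm'
  have large (k : M.Num) : ∃ y, pair (k₀ + k) y ∈ G ∧ k ≤ y := by
    refine induction_sigma1 (fun k => ∃ y, pair (k₀ + k) y ∈ G ∧ k ≤ y) ?_ (fun k ih => ?_) k
    · obtain ⟨y, -, hy⟩ := hG.2.2.1 (k₀ + 0)
      exact ⟨y, hy, Num.zero_le y⟩
    · obtain ⟨y, hy, hk⟩ := ih
      obtain ⟨z, -, hz⟩ := hG.2.2.1 (k₀ + (k + 1))
      refine ⟨z, hz, lt_iff_add_one_le.1 (hk.trans_lt ?_)⟩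
      by_contra! hzy
      refine bad _ _ _ _ ?_ hy hz ((colourOrder_iff hF (stable le_self_add hy)
        (stable le_self_add hz)).2 (Or.inr ⟨rfl, hzy⟩))
      rw [← add_assoc]
      exact lt_add_one_iff.2 le_rfl
  refine ⟨m, fun k => ?_⟩
  obtain ⟨y, hy, hk⟩ := large (k + 1)
  exact ⟨y, lt_iff_add_one_le.2 hk, stable le_self_add hy⟩

theorem isQuasiOrder_colourOrder {F : Set M.Num} {n : M.Num} (hF : IsFun F {m | m < n}) :
    IsQuasiOrder Set.univ (graph (colourOrder F n)) := by
  have : Fact (F ∈ M.sets) := ⟨hF.1⟩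
  refine ⟨?_, graph_mem_sets (hP := fun s t hs ht => ?_) _, fun z ⟨x, y, hz, _⟩ =>
    ⟨x, trivial, y, trivial, hz⟩, fun q _ => ?_, fun p _ q _ r _ => ?_⟩
  · have := comprehension_delta0 fun x : M.Num => x = x
    rwa [Set.eq_univ_of_forall (s := {x : M.Num | x = x}) fun x => rfl] at this
  · unfold colourOrder
    infer_instance
  · obtain ⟨a, -, ha⟩ := hF.2.2.1 q
    exact pair_mem_graph.2 ((colourOrder_iff hF ha ha).2 (Or.inr ⟨rfl, le_rfl⟩))
  · obtain ⟨a, -, ha⟩ := hF.2.2.1 p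
    obtain ⟨b, -, hb⟩ := hF.2.2.1 q
    obtain ⟨c, -, hc⟩ := hF.2.2.1 r
    simp only [pair_mem_graph, colourOrder_iff hF ha hb, colourOrder_iff hF hb hc,
      colourOrder_iff hF ha hc]
    rintro (h | ⟨rfl, h⟩) (h' | ⟨rfl, h'⟩)
    exacts [Or.inl (h'.trans h), Or.inl h, Or.inl h', Or.inr ⟨rfl, h'.trans h⟩]

/-- If the colouring had no infinite monochromatic set, then all numbers with `colourOrder` would
be a wqo, but the sequence of the pairs `(colour of k, k)` would be bad for the product order. -/
theorem WQPProductOrder.infinitePigeonhole (h : M.WQPProductOrder) : M.InfinitePigeonhole := by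
  intro n F hF
  have hF' : Fact (F ∈ M.sets) := ⟨hF.1⟩
  by_contra! hcon
  have wqo : IsWqo Set.univ (graph (colourOrder F n)) := by
    refine ⟨isQuasiOrder_colourOrder hF, fun G hG => ?_⟩
    by_contra! hbad
    obtain ⟨m, hm⟩ := exists_infinite_of_bad hF hG fun i j p q hij hp hq hpq =>
      hbad i j p q hij hp hq (pair_mem_graph.2 hpq)
    obtain ⟨j, -, hj⟩ := hm 0
    obtain ⟨x, hx, hx'⟩ := hcon {x | pair x m ∈ F} (comprehension_delta0 fun x => pair x m ∈ F)
      (fun k => (hm k).imp fun j hj => ⟨hj.2, hj.1⟩) m (hF.mem hj)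
    exact hx' hx
  -- The sequence of the pairs of the colour of `k` and `k` itself is bad.
  have seq : IsFun (graph fun k z : M.Num => ∃ m, m < n ∧ z = pair m k ∧ pair k m ∈ F)
      (copies n Set.univ) := by
    refine isFun_graph _ (hP := fun s t hs ht => ?_) (fun k => ?_) ?_
    · infer_instance
    · obtain ⟨m, hm, hk⟩ := hF.2.2.1 k
      exact ⟨pair m k, pair_mem_copies.2 ⟨hm, trivial⟩, m, hm, rfl, hk⟩
    · rintro k _ _ ⟨m, _, rfl, hm⟩ ⟨m', _, rfl, hm'⟩
      rw [hF.2.2.2 _ _ _ hm hm']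
  obtain ⟨i, j, p, q, hij, hp, hq, hpq⟩ := (h n _ _ wqo).2 _ seq
  obtain ⟨m, _, rfl, hm⟩ := pair_mem_graph.1 hp
  obtain ⟨m', _, rfl, hm'⟩ := pair_mem_graph.1 hq
  obtain ⟨-, -, -, -, hle, hR⟩ := pair_mem_copiesOrder (S := fun a b => a ≤ b).1 hpq
  rw [pair_mem_graph, colourOrder_iff hF hm hm'] at hR
  obtain hlt | ⟨-, hji⟩ := hR
  exacts [hlt.not_ge hle, hij.not_ge hji]

/-! ### The disjoint order from the pigeonhole principle -/

/-- An infinite set is the range of a strictly increasing function. -/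
theorem exists_increasing_enumeration {A : Set M.Num} (hA : A ∈ M.sets)
    (hinf : ∀ k, ∃ j ∈ A, k < j) :
    ∃ E : Set M.Num, IsFun E A ∧ ∀ i j x y, i < j → pair i x ∈ E → pair j y ∈ E → x < y := by
  have : Fact (A ∈ M.sets) := ⟨hA⟩
  obtain ⟨a, ha, -⟩ := hinf 0
  obtain ⟨E, hE, hE₀, hE'⟩ := exists_iterates
    (fun x y => (y ∈ A ∧ x < y) ∧ ∀ z, z < y → ¬ (z ∈ A ∧ x < z))
    (hH := fun _ _ _ _ => inferInstance)
    (fun x => by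
      obtain ⟨j, hj, hxj⟩ := hinf x
      exact exists_least (fun y => y ∈ A ∧ x < y) ⟨hj, hxj⟩)
    (fun x y z ⟨hy, hy'⟩ ⟨hz, hz'⟩ =>
      le_antisymm (not_lt.1 fun h => hy' z h hz) (not_lt.1 fun h => hz' y h hy)) a
  have : Fact (E ∈ M.sets) := ⟨hE.1⟩
  refine ⟨E, ⟨hE.1, hE.2.1, fun k => ?_, hE.2.2.2⟩, fun i j x y hij hx hy => ?_⟩
  · obtain rfl | ⟨k, rfl⟩ := eq_zero_or_exists_add_one k
    · exact ⟨a, ha, hE₀⟩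
    · obtain ⟨x, -, hx⟩ := hE.2.2.1 k
      obtain ⟨y, -, hy⟩ := hE.2.2.1 (k + 1)
      exact ⟨y, (hE' _ _ _ hx hy).1.1, hy⟩
  · obtain ⟨z, hz, hxz⟩ := induction_sigma1 (fun j => ∃ z, pair j z ∈ E ∧ (i < j → x < z))
      ⟨a, hE₀, fun h => (Num.not_lt_zero i h).elim⟩ (fun j ih => by
        obtain ⟨z, hz, hxz⟩ := ih
        obtain ⟨w, -, hw⟩ := hE.2.2.1 (j + 1)
        have hzw := (hE' _ _ _ hz hw).1.2
        refine ⟨w, hw, fun h => ?_⟩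
        rcases (lt_add_one_iff.1 h).lt_or_eq with h | rfl
        · exact (hxz h).trans hzw
        · exact hE.2.2.2 _ _ _ hz hx ▸ hzw) j
    exact hE.2.2.2 _ _ _ hz hy ▸ hxz hij

/-- A sequence in `n × Q` has a subsequence with constant first component. -/
theorem InfinitePigeonhole.wqpDisjointUnion (h : M.InfinitePigeonhole) : M.WQPDisjointUnion := by
  intro n Q R hQ
  refine ⟨hQ.1.copiesOrder (S := fun a b => a = b) (hS := fun _ _ _ _ => inferInstance)
    (fun _ => rfl) (fun _ _ _ => Eq.trans) n, fun F hF => ?_⟩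
  have : Fact (F ∈ M.sets) := ⟨hF.1⟩
  have colour : IsFun (graph fun k m : M.Num => ∃ q, pair k (pair m q) ∈ F) {m | m < n} := by
    refine isFun_graph _ (hP := fun s t hs ht => ?_) (fun k => ?_) ?_
    · infer_instance
    · obtain ⟨_, ⟨m, q, hm, -, rfl⟩, hk⟩ := hF.2.2.1 k
      exact ⟨m, hm, q, hk⟩
    · rintro k m m' ⟨q, hq⟩ ⟨q', hq'⟩
      exact (pair_inj.1 (hF.2.2.2 _ _ _ hq hq')).1
  obtain ⟨A, hA, hinf, m, hm, hAm⟩ := h n _ colour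
  obtain ⟨E, hE, hmono⟩ := exists_increasing_enumeration hA hinf
  have : Fact (E ∈ M.sets) := ⟨hE.1⟩
  have seq : IsFun (graph fun k q : M.Num => ∃ x, pair k x ∈ E ∧ pair x (pair m q) ∈ F) Q := by
    refine isFun_graph _ (hP := fun s t hs ht => ?_) (fun k => ?_) ?_
    · infer_instance
    · obtain ⟨x, hx, hkx⟩ := hE.2.2.1 k
      obtain ⟨q, hq⟩ := pair_mem_graph.1 (hAm x hx)
      obtain ⟨y, hy, hxy⟩ := hF.2.2.1 x
      obtain rfl := hF.2.2.2 _ _ _ hq hxy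
      exact ⟨q, (pair_mem_copies.1 hy).2, x, hkx, hq⟩
    · rintro k q q' ⟨x, hx, hq⟩ ⟨x', hx', hq'⟩
      obtain rfl := hE.2.2.2 _ _ _ hx hx'
      exact (pair_inj.1 (hF.2.2.2 _ _ _ hq hq')).2
  obtain ⟨i, j, p, q, hij, hp, hq, hpq⟩ := hQ.2 _ seq
  obtain ⟨x, hx, hxp⟩ := pair_mem_graph.1 hp
  obtain ⟨y, hy, hyq⟩ := pair_mem_graph.1 hq
  exact ⟨x, y, _, _, hmono i j x y hij hx hy, hxp, hyq, pair_mem_copiesOrder.2 ⟨hm, hm,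
    (pair_mem_copies.1 (hF.mem hxp)).2, (pair_mem_copies.1 (hF.mem hyq)).2, rfl, hpq⟩⟩

/-! ### Collection and the pigeonhole principle -/

/-- Collection for `Π⁰₁` predicates, as an instance of `BΣ⁰₂`. -/
theorem BSigma2.collection (h : M.BSigma2) (P : M.Num → M.Num → M.Num → Prop)
    [hP : IsDelta0 fun u => P (u 0) (u 1) (u 2)] {a : M.Num} (ha : ∀ b ≤ a, ∃ c, ∀ g, P b c g) :
    ∃ d, ∀ b ≤ a, ∃ c ≤ d, ∀ g, P b c g := by
  obtain ⟨φ, V, p, hφ, hP⟩ := hP.exists_formula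
  have key (b c : M.Num) : M.Sat V (Function.update (Function.update (join (fun _ => 0) p)
      (split (.inl 0)) b) (split (.inl 1)) c)
      (.ex (split (.inl 3)) (.all (split (.inl 2)) φ)) ↔ ∀ g, P b c g := by
    simp [Sat, update_join_inl, hP]
  have := h (.ex (split (.inl 3)) (.all (split (.inl 2)) φ)) ⟨_, _, rfl, _, _, rfl, hφ⟩
    (split (.inl 0)) (split (.inl 1)) (by simp) V (join (fun _ => 0) p) a
  simp only [key] at this
  exact this ha

/-- Otherwise each colour has a last occurrence, and collection bounds all of them. -/
theorem BSigma2.infinitePigeonhole (h : M.BSigma2) : M.InfinitePigeonhole := by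
  intro n F hF
  have : Fact (F ∈ M.sets) := ⟨hF.1⟩
  obtain ⟨m, hm, -⟩ := hF.2.2.1 0
  obtain rfl | ⟨a, rfl⟩ := eq_zero_or_exists_add_one n
  · exact (Num.not_lt_zero m hm).elim
  by_contra! hcon
  obtain ⟨d, hd⟩ := h.collection (fun b c g => c < g → ¬ pair g b ∈ F) (a := a) fun b hb => by
    by_contra! hb'
    obtain ⟨x, hx, hx'⟩ := hcon {x | pair x b ∈ F} (comprehension_delta0 fun x => pair x b ∈ F)
      (fun k => (hb' k).imp fun j hj => ⟨hj.2, hj.1⟩) b (lt_add_one_iff.2 hb)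
    exact hx' hx
  obtain ⟨b, hb, hdb⟩ := hF.2.2.1 (d + 1)
  obtain ⟨c, hc, hcb⟩ := hd b (lt_add_one_iff.1 hb)
  exact hcb _ (lt_add_one_iff.2 hc) hdb

/-- Collection for a `Σ⁰₂` predicate with matrix `T`: each stage `s` is coloured by an argument
`b` for which the least bound of witnesses not refuted before `s` is greatest. If `b` is the colour
of infinitely many stages, then true witnesses for `b` bound the witnesses for all arguments. -/
theorem InfinitePigeonhole.collection (h : M.InfinitePigeonhole)
    (T : M.Num → M.Num → M.Num → M.Num → Prop)
    [hT : ∀ (s₁ s₂ s₃ s₄ : (ℕ → M.Num) → M.Num) [IsTerm s₁] [IsTerm s₂] [IsTerm s₃] [IsTerm s₄],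
      IsDelta0 fun u => T (s₁ u) (s₂ u) (s₃ u) (s₄ u)]
    {a : M.Num} (ha : ∀ b ≤ a, ∃ c e, ∀ g, T b c e g) :
    ∃ d, ∀ b ≤ a, ∃ c ≤ d, ∃ e, ∀ g, T b c e g := by
  -- `Ψ b v s`: at stage `s`, some witnesses for `b` up to `v` have not been refuted.
  let Ψ (b v s : M.Num) : Prop := ∃ c, c < v + 1 ∧ ∃ e, e < v + 1 ∧ ∀ g, g < s → T b c e g
  have hΨ (r s t : (ℕ → M.Num) → M.Num) [hr : IsTerm r] [hs : IsTerm s] [ht : IsTerm t] :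
      IsDelta0 fun u => Ψ (r u) (s u) (t u) := by
    simp only [Ψ]
    infer_instance
  have mono {b v w s t : M.Num} (hvw : v ≤ w) (hst : s ≤ t) : Ψ b v t → Ψ b w s :=
    fun ⟨c, hc, e, he, H⟩ => ⟨c, lt_add_one_iff.2 ((lt_add_one_iff.1 hc).trans hvw), e,
      lt_add_one_iff.2 ((lt_add_one_iff.1 he).trans hvw), fun g hg => H g (hg.trans_le hst)⟩
  -- `E s v`: at stage `s`, all arguments have unrefuted witnesses up to `v`. The case `v = s`
  -- ensures that some `v` exists.
  let E (s v : M.Num) : Prop := v = s ∨ ∀ b, b < a + 1 → Ψ b v s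
  have hE (s t : (ℕ → M.Num) → M.Num) [IsTerm s] [IsTerm t] : IsDelta0 fun u => E (s u) (t u) := by
    simp only [E]
    infer_instance
  -- `C s b`: for the least `v` with `E s v`, the argument `b` is the first without unrefuted
  -- witnesses up to any `w < v`.
  let C (s b : M.Num) : Prop := b < a + 1 ∧ ∃ v, v < s + 1 ∧ (E s v ∧ ∀ w, w < v → ¬ E s w) ∧
    (∀ w, w < v → ¬ Ψ b w s) ∧ ∀ b', b' < b → ¬ ∀ w, w < v → ¬ Ψ b' w s
  have hC : IsFun (graph C) {b | b < a + 1} := by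
    refine isFun_graph C (hP := fun s t hs ht => ?_) (fun s => ?_) ?_
    · simp only [C]
      infer_instance
    · obtain ⟨v, hv, hmin⟩ := exists_least (E s) (hP := hE _ _) (n := s) (Or.inl rfl)
      have hvs : v ≤ s := not_lt.1 fun h => hmin s h (Or.inl rfl)
      obtain ⟨b₀, hb₀, hvb₀⟩ : ∃ b, b < a + 1 ∧ ∀ w, w < v → ¬ Ψ b w s := by
        obtain rfl | ⟨w, rfl⟩ := eq_zero_or_exists_add_one v
        · exact ⟨0, Num.zero_lt_succ a, fun w hw => (Num.not_lt_zero w hw).elim⟩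
        · have := hmin w (lt_add_one_iff.2 le_rfl)
          simp only [E, not_or, not_forall] at this
          obtain ⟨-, b, hb, hbw⟩ := this
          exact ⟨b, hb, fun w' hw' h => hbw (mono (lt_add_one_iff.1 hw') le_rfl h)⟩
      obtain ⟨b, hb, hbmin⟩ := exists_least (fun b => ∀ w, w < v → ¬ Ψ b w s) hvb₀
      exact ⟨b, (not_lt.1 fun h => hbmin b₀ h hvb₀).trans_lt hb₀,
        (not_lt.1 fun h => hbmin b₀ h hvb₀).trans_lt hb₀, v, lt_add_one_iff.2 hvs, ⟨hv, hmin⟩, hb,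
        hbmin⟩
    · rintro s b b' ⟨_, v, _, ⟨hv, hvmin⟩, hb, hbmin⟩ ⟨_, v', _, ⟨hv', hvmin'⟩, hb', hbmin'⟩
      obtain rfl : v = v' :=
        le_antisymm (not_lt.1 fun h => hvmin _ h hv') (not_lt.1 fun h => hvmin' _ h hv)
      exact le_antisymm (not_lt.1 fun h => hbmin _ h hb') (not_lt.1 fun h => hbmin' _ h hb)
  obtain ⟨A, hA, hinf, b₀, hb₀, hAb₀⟩ := h _ _ hC
  -- A bound for true witnesses for the colour `b₀` is a bound for all arguments.
  obtain ⟨c₀, e₀, hce⟩ := ha b₀ (lt_add_one_iff.1 hb₀)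
  have bound (b s : M.Num) (hb : b ≤ a) : Ψ b (c₀ + e₀) s := by
    obtain ⟨t, htA, hst⟩ := hinf (s + (c₀ + e₀))
    obtain ⟨-, v, -, ⟨hv, -⟩, hvb₀, -⟩ := pair_mem_graph.1 (hAb₀ t htA)
    have hvle : v ≤ c₀ + e₀ := not_lt.1 fun h => hvb₀ _ h
      ⟨c₀, lt_add_one_iff.2 le_self_add, e₀, lt_add_one_iff.2 le_add_self, fun g _ => hce g⟩
    rcases hv with rfl | hv
    · exact ((le_add_self.trans_lt hst).not_ge hvle).elim
    · exact mono hvle (le_self_add.trans hst.le) (hv b (lt_add_one_iff.2 hb))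
  refine ⟨c₀ + e₀, fun b hb => ?_⟩
  by_contra! hcon
  -- Bounding turns the refutations of all small witnesses into refutations at one stage.
  obtain ⟨s, hs⟩ := exists_bound
    (fun c s => ∀ e, e < c₀ + e₀ + 1 → ∃ g, g < s ∧ ¬ T b c e g) (a := c₀ + e₀ + 1) fun c hc =>
      exists_bound (fun e g => ¬ T b c e g) fun e _ => hcon c (lt_add_one_iff.1 hc) e
  obtain ⟨c, hc, e, he, hT⟩ := bound b s hb
  obtain ⟨t, hts, ht⟩ := hs c hc
  obtain ⟨g, hg, hgT⟩ := ht e he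
  exact hgT (hT g (hg.trans hts))

theorem InfinitePigeonhole.bSigma2 (h : M.InfinitePigeonhole) : M.BSigma2 := by
  rintro φ ⟨z, _, rfl, w, θ, rfl, hθ⟩ x y - V v a ha
  refine h.collection (fun b c e g => M.Sat V (Function.update (Function.update (Function.update
    (Function.update v x b) y c) z e) w g) θ) (hT := fun s₁ s₂ s₃ s₄ _ _ _ _ => ?_) ha
  exact IsDelta0.sat hθ V (σ := fun u => Function.update (Function.update (Function.update
    (Function.update v x (s₁ u)) y (s₂ u)) z (s₃ u)) w (s₄ u))
    (.update (.update (.update (.update (fun i => .const (v i)) x) y) z) w)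

end Principles

end L2Structure

/-- Over `RCA₀` the four principles are equivalent, i.e. they are equivalent in every
(not necessarily standard) model of `RCA₀`. -/
theorem mainTheorem6 (M : L2Structure.{u}) (hM : M.IsModelRCA0) :
    List.TFAE [M.WQPDisjointUnion, M.WQPProductOrder, M.InfinitePigeonhole, M.BSigma2] := by
  have : Fact M.IsModelRCA0 := ⟨hM⟩
  tfae_have 1 → 2 := L2Structure.WQPDisjointUnion.wqpProductOrder
  tfae_have 2 → 3 := L2Structure.WQPProductOrder.infinitePigeonhole
  tfae_have 3 → 1 := L2Structure.InfinitePigeonhole.wqpDisjointUnion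
  tfae_have 3 → 4 := L2Structure.InfinitePigeonhole.bSigma2
  tfae_have 4 → 3 := L2Structure.BSigma2.infinitePigeonhole
  tfae_finish
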